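/- Let $N\ge 1$, $q\in\mathbb C\setminus\{0\}$ with $q^2\neq 1$, and let $\eta_1,\dots,\eta_N\in\mathbb C\setminus\{0\}$ satisfy $\eta_a^2\neq q^{2j}\eta_b^2$ for all $a<b$ and $j\in\{-1,0,1\}$. On $(\mathbb C^2)^{\otimes N}$ let $\sigma_n^{\pm},\sigma_n^z$ be the Pauli matrices acting on the $n$-th factor ($\sigma^z=\mathrm{diag}(1,-1)$, $\sigma^-$ maps the spin $+1$ basis vector to the spin $-1$ one). Put $x_\pm(\lambda)=\tfrac12\big(\lambda q-\tfrac1{\lambda q}\pm(\lambda-\tfrac1\lambda)\big)$ and $$\mathsf L_n(\lambda)=\begin{pmatrix}x_+(\lambda)+x_-(\lambda)\sigma_n^z&(q-q^{-1})\sigma_n^-\\(q-q^{-1})\sigma_n^+&x_+(\lambda)-x_-(\lambda)\sigma_n^z\end{pmatrix},\qquad \begin{pmatrix}\mathsf A(\lambda)&\mathsf B(\lambda)\\ \mathsf C(\lambda)&\mathsf D(\lambda)\end{pmatrix}=\mathsf L_N(\lambda/\eta_N)\cdots\mathsf L_1(\lambda/\eta_1),$$ and let $\bar{\mathsf T}(\lambda)=\mathsf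 B(\lambda)+\mathsf C(\lambda)$ be the antiperiodic transfer matrix. Put $$a(\lambda)=-\prod_{n=1}^N\Big(\frac{\lambda q}{\eta_n}-\frac{\eta_n}{\lambda q}\Big),\qquad d(\lambda)=\prod_{n=1}^N\Big(\frac{\lambda}{\eta_n}-\frac{\eta_n}{\lambda}\Big),\qquad \omega(x)=x^{N-1}.$$ Let $\nu$ be any complex number with $\nu^2=\prod_{1\le b<a\le N}(\eta_a/\eta_b-\eta_b/\eta_a)$, let $|0\rangle$ and $\langle0|$ be the vector and the covector with all spins $+1$, and for $\mathbf h\in\{0,1\}^N$ put $$\langle\mathbf h|=\frac1\nu\langle0|\prod_{n=1}^N\Big(\frac{\mathsf C(\eta_n)}{d(\eta_n/q)}\Big)^{h_n},\qquad|\mathbf h\rangle=\frac1\nu\prod_{n=1}^N\Big(\frac{\mathsf B(\eta_n)}{a(\eta_n)}\Big)^{h_n}|0\rangle .$$ Let $\langle t|\neq0$ be a left and $|t'\rangle\neq0$ a right eigenstate of $\bar{\mathsf T}$, that is, $\langle t|\bar{\mathsf T}(\lambda)=t(\lambda)\langle t|$ and $\bar{\mathsf T}(\lambda)|t'\rangle=t'(\lambda)|t'\rangle$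 for all $\lambda\neq0$. Then there are functions $\bar Q_t$ and $Q_{t'}$, non-zero at every $\eta_a$, such that $$\frac{\bar Q_t(\eta_a/q)}{\bar Q_t(\eta_a)}=\frac{t(\eta_a)}{a(\eta_a)},\qquad\frac{Q_{t'}(\eta_a/q)}{Q_{t'}(\eta_a)}=\frac{t'(\eta_a)}{d(\eta_a/q)}\qquad(1\le a\le N)$$ and $$\langle t|=\sum_{\mathbf h}\prod_{a=1}^N\frac{\bar Q_t(\eta_aq^{-h_a})}{\omega(\eta_aq^{-h_a})}\prod_{b<a}(\eta_a^2q^{-2h_a}-\eta_b^2q^{-2h_b})\,\langle\mathbf h|,\qquad|t'\rangle=\sum_{\mathbf h}\prod_{a=1}^N\frac{Q_{t'}(\eta_aq^{-h_a})}{\omega(\eta_aq^{-h_a})}\prod_{b<a}(\eta_a^2q^{-2h_a}-\eta_b^2q^{-2h_b})\,|\mathbf h\rangle ,$$ and for all such $\bar Q_t,Q_{t'}$ and every $n\in\{1,\dots,N\}$, $$\langle t|\sigma_n^-|t'\rangle=\frac{\prod_{h=1}^{n-1}t(\eta_h)\prod_{h=1}^{n}t'(\eta_h/q)}{\prod_{h=1}^na(\eta_h)\,d(\eta_h/q)}\;\det_{N+1}\big\|\mathcal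 S_{a,b}\big\|,$$ where $\mathcal S$ is the $(N+1)\times(N+1)$ matrix with $$\mathcal S_{a,b}=\Phi_{a,b-1/2}\quad(1\le a\le N),\qquad\mathcal S_{N+1,b}=\eta_n^{2(b-1)-N}\qquad(1\le b\le N+1),$$ $$\Phi_{a,\beta}=\eta_a^{2(\beta-1)}\sum_{c=0}^1\frac{Q_{t'}(\eta_aq^{-c})\,\bar Q_t(\eta_aq^{-c})}{\omega(\eta_aq^{-c})}\,q^{-2(\beta-1)c}.$$ -/

import Mathlib

open scoped Matrix BigOperators

noncomputable section

namespace AntiXXZ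

/-- Spin configurations of a chain with `N` sites; the value `0` at a site stands for spin `+1`,
the value `1` for spin `-1`. They index the spin basis of the `N`-fold tensor power of `ℂ²`. -/
abbrev Conf (N : ℕ) : Type := Fin N → Fin 2

/-- Operators on the chain, as matrices in the spin basis. -/
abbrev Op (N : ℕ) : Type := Matrix (Conf N) (Conf N) ℂ

/-- Coordinates of a vector (in the spin basis) or of a covector (in the dual spin basis). -/
abbrev Vec (N : ℕ) : Type := Conf N → ℂ

/-- The `2 × 2` matrix `X` acting on site `n`, and the identity acting on all other sites. -/
def localOp {N : ℕ} (X : Matrix (Fin 2) (Fin 2) ℂ) (n : Fin N) : Op N :=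
  Matrix.of fun s s' => if ∀ m, m ≠ n → s m = s' m then X (s n) (s' n) else 0

/-- `σ_n^-`, which sends spin `+1` to spin `-1` at site `n`. -/
def sigmaMinus {N : ℕ} (n : Fin N) : Op N := localOp !![0, 0; 1, 0] n

/-- `σ_n^+`, which sends spin `-1` to spin `+1` at site `n`. -/
def sigmaPlus {N : ℕ} (n : Fin N) : Op N := localOp !![0, 1; 0, 0] n

/-- `σ_n^z`. -/
def sigmaZ {N : ℕ} (n : Fin N) : Op N := localOp !![1, 0; 0, -1] n

/-- `x_+(l) = (l q - 1/(q l) + l - 1/l) / 2`. -/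
def xPlus (q l : ℂ) : ℂ := (l * q - (q * l)⁻¹ + l - l⁻¹) / 2

/-- `x_-(l) = (l q - 1/(q l) - l + 1/l) / 2`; the sign `±` of `x_±` multiplies `l - 1/l`. -/
def xMinus (q l : ℂ) : ℂ := (l * q - (q * l)⁻¹ - (l - l⁻¹)) / 2

/-- The 6-vertex Lax operator at site `n`: a `2 × 2` matrix over the auxiliary space whose entries
are operators on the chain. -/
def lax {N : ℕ} (q : ℂ) (n : Fin N) (l : ℂ) : Matrix (Fin 2) (Fin 2) (Op N) :=
  !![xPlus q l • (1 : Op N) + xMinus q l • sigmaZ n, (q - q⁻¹) • sigmaMinus n;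
     (q - q⁻¹) • sigmaPlus n, xPlus q l • (1 : Op N) - xMinus q l • sigmaZ n]

/-- The monodromy matrix `L_N(l/η_N) ⋯ L_1(l/η_1)`. -/
def monodromy {N : ℕ} (q : ℂ) (η : Fin N → ℂ) (l : ℂ) : Matrix (Fin 2) (Fin 2) (Op N) :=
  (List.ofFn fun n : Fin N => lax q n (l / η n)).reverse.prod

/-- The upper right entry `B(l)` of the monodromy matrix. -/
def opB {N : ℕ} (q : ℂ) (η : Fin N → ℂ) (l : ℂ) : Op N := monodromy q η l 0 1

/-- The lower left entry `C(l)` of the monodromy matrix. -/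
def opC {N : ℕ} (q : ℂ) (η : Fin N → ℂ) (l : ℂ) : Op N := monodromy q η l 1 0

/-- The antiperiodic transfer matrix `T̄(l) = B(l) + C(l)`. -/
def transfer {N : ℕ} (q : ℂ) (η : Fin N → ℂ) (l : ℂ) : Op N := opB q η l + opC q η l

/-- `a(l) = - ∏ (l q / η_n - η_n / (l q))`. -/
def aFun {N : ℕ} (q : ℂ) (η : Fin N → ℂ) (l : ℂ) : ℂ :=
  -∏ n, (l * q / η n - η n / (l * q))

/-- `d(l) = ∏ (l / η_n - η_n / l)`. -/
def dFun {N : ℕ} (η : Fin N → ℂ) (l : ℂ) : ℂ := ∏ n, (l / η n - η n / l)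

/-- `ω(x) = x ^ (N - 1)` (an integer exponent). -/
def omega (N : ℕ) (x : ℂ) : ℂ := x ^ ((N : ℤ) - 1)

/-- The reference state, all spins equal to `+1`; as a vector it is `|0⟩`, as a covector `⟨0|`. -/
def refState (N : ℕ) : Vec N := Pi.single 0 1

/-- The covector `⟨h_1, …, h_N| = ν⁻¹ ⟨0| ∏ (C(η_n) / d(η_n/q)) ^ h_n`. -/
def leftSov {N : ℕ} (q : ℂ) (η : Fin N → ℂ) (ν : ℂ) (h : Conf N) : Vec N :=
  ν⁻¹ • (refState N ᵥ*
    (List.ofFn fun n : Fin N => ((dFun η (η n / q))⁻¹ • opC q η (η n)) ^ (h n : ℕ)).prod)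

/-- The vector `|h_1, …, h_N⟩ = ν⁻¹ ∏ (B(η_n) / a(η_n)) ^ h_n |0⟩`. -/
def rightSov {N : ℕ} (q : ℂ) (η : Fin N → ℂ) (ν : ℂ) (h : Conf N) : Vec N :=
  ν⁻¹ • ((List.ofFn fun n : Fin N => ((aFun q η (η n))⁻¹ • opB q η (η n)) ^ (h n : ℕ)).prod *ᵥ
    refState N)

/-- The point `η_a q^{-h_a}`. -/
def node {N : ℕ} (q : ℂ) (η : Fin N → ℂ) (h : Conf N) (a : Fin N) : ℂ :=
  η a * q ^ (-((h a : ℕ) : ℤ))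

/-- The coefficient `∏_a f(η_a q^{-h_a}) / ω(η_a q^{-h_a})
  ∏_{b < a} (η_a² q^{-2 h_a} - η_b² q^{-2 h_b})` of a separate state. -/
def sepCoeff {N : ℕ} (q : ℂ) (η : Fin N → ℂ) (f : ℂ → ℂ) (h : Conf N) : ℂ :=
  (∏ a, f (node q η h a) / omega N (node q η h a)) *
    ∏ a, ∏ b ∈ Finset.Iio a, (node q η h a ^ 2 - node q η h b ^ 2)

/-- The separate covector with wave function `f`. -/
def leftSep {N : ℕ} (q : ℂ) (η : Fin N → ℂ) (ν : ℂ) (f : ℂ → ℂ) : Vec N :=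
  ∑ h : Conf N, sepCoeff q η f h • leftSov q η ν h

/-- The separate vector with wave function `f`. -/
def rightSep {N : ℕ} (q : ℂ) (η : Fin N → ℂ) (ν : ℂ) (f : ℂ → ℂ) : Vec N :=
  ∑ h : Conf N, sepCoeff q η f h • rightSov q η ν h

/-- `L` is a left eigenstate of the family `T̄(l)`, with eigenvalue function `t(l)`. -/
def IsLeftEigenstate {N : ℕ} (q : ℂ) (η : Fin N → ℂ) (t : ℂ → ℂ) (L : Vec N) : Prop :=
  L ≠ 0 ∧ ∀ l : ℂ, l ≠ 0 → L ᵥ* transfer q η l = t l • L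

/-- `R` is a right eigenstate of the family `T̄(l)`, with eigenvalue function `t(l)`. -/
def IsRightEigenstate {N : ℕ} (q : ℂ) (η : Fin N → ℂ) (t : ℂ → ℂ) (R : Vec N) : Prop :=
  R ≠ 0 ∧ ∀ l : ℂ, l ≠ 0 → transfer q η l *ᵥ R = t l • R

/-- `Qbar` is a wave function of the left eigenstate `L`: its values on the points `η_a`, `η_a/q`
satisfy `Qbar(η_a/q) / Qbar(η_a) = t(η_a) / a(η_a)`, and `L` is the separate covector it defines. -/
def IsLeftWave {N : ℕ} (q : ℂ) (η : Fin N → ℂ) (ν : ℂ) (t : ℂ → ℂ) (L : Vec N)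
    (Qbar : ℂ → ℂ) : Prop :=
  (∀ a, Qbar (η a) ≠ 0 ∧ Qbar (η a / q) / Qbar (η a) = t (η a) / aFun q η (η a)) ∧
    L = leftSep q η ν Qbar

/-- `Q` is a wave function of the right eigenstate `R`: its values on the points `η_a`, `η_a/q`
satisfy `Q(η_a/q) / Q(η_a) = t(η_a) / d(η_a/q)`, and `R` is the separate vector it defines. -/
def IsRightWave {N : ℕ} (q : ℂ) (η : Fin N → ℂ) (ν : ℂ) (t : ℂ → ℂ) (R : Vec N)
    (Q : ℂ → ℂ) : Prop :=
  (∀ a, Q (η a) ≠ 0 ∧ Q (η a / q) / Q (η a) = t (η a) / dFun η (η a / q)) ∧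
    R = rightSep q η ν Q

/-- `Φ_{a, k/2}`, where
`Φ_{a, β} = η_a ^ (2 (β - 1)) ∑_{c = 0, 1} Q(η_a q^{-c}) Qbar(η_a q^{-c}) / ω(η_a q^{-c})
  q ^ (-2 (β - 1) c)`; for a half-integer `β = k/2` one has `2 (β - 1) = k - 2`. -/
def phiHalf {N : ℕ} (q : ℂ) (η : Fin N → ℂ) (Qbar Q : ℂ → ℂ) (a : Fin N) (k : ℤ) : ℂ :=
  η a ^ (k - 2) * ∑ c ∈ Finset.range 2,
    Q (η a * q ^ (-(c : ℤ))) * Qbar (η a * q ^ (-(c : ℤ))) / omega N (η a * q ^ (-(c : ℤ))) *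
      q ^ (-((k - 2) * (c : ℤ)))

/-- The `(N+1) × (N+1)` matrix `S^{(-,t,t')}`: with 1-based indices, its entry in row `a ≤ N` and
column `b` is `Φ_{a, b - 1/2}`, and its last row is `η_n ^ (2 (b - 1) - N)`. The Lean index `b` is
0-based, so that `b - 1/2` becomes `(2 b + 1) / 2` and `2 (b - 1) - N` becomes `2 b - N`. -/
def formMatrix {N : ℕ} (q : ℂ) (η : Fin N → ℂ) (Qbar Q : ℂ → ℂ) (n : Fin N) :
    Matrix (Fin (N + 1)) (Fin (N + 1)) ℂ :=
  Matrix.of (Fin.snoc (α := fun _ => Fin (N + 1) → ℂ)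
    (fun a b => phiHalf q η Qbar Q a (2 * ((b : ℕ) : ℤ) + 1))
    (fun b => η n ^ (2 * ((b : ℕ) : ℤ) - (N : ℤ))))

end AntiXXZ

end

noncomputable section

namespace AntiXXZ


/-! ### The R-matrix exchange relations -/

/-! The matrix element of σ_n^- is reduced to one of D(η_n) between the same eigenstates, and the
latter is computed in bases where D is diagonal.

Reduction: at λ = η_i the Lax matrix of site i is a permutation (`smallLax_one`), so the transfer
matrix T̄(η_i) carries site i from the right end of the monodromy product to the left end,
conjugated by σ^x (`twistedTrace_mul`). After the preceding sites have been carried over, σ_i^-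
times the next shift is an entry D of the shifted monodromy, whence `sigmaMinus_mul_transferProd`.
At λ = η_i/q the same Lax matrix has rank one, only the quantum determinant survives, and t'(η_i)
t'(η_i/q) = a(η_i) d(η_i/q) (`eigenvalue_mul_eigenvalue`). This trades the factors 1/t'(η_h) for
those of the statement (`dotProduct_sigmaMinus`).

Separation of variables: D(λ) is diagonal on the states labelled by h, with zeros at the points ±η_a
q^{-h_a} (`IsSov.vecMul_D`). The two families are biorthogonal, and the inverse norms are products
over pairs of sites (`leftSov_dotProduct_rightSov`). When h_a = 0, T̄(η_a) merely raises h_a, so the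
coordinates of an eigenstate obey a one-step recursion at each site and factorise
(`exists_wave_of_biorthogonal`).

Hence the matrix element of D(η_n) is a sum over h of a product over sites times a Vandermonde
product in the N + 1 points η_a² q^{-2h_a} and η_n². Multilinearity of the determinant in its first
N rows resums it (`det_formMatrix`). -/

/-- Diagonal weights of the six-vertex R-matrix. -/
def rDiag (q x : ℂ) (i j : Fin 2) : ℂ := if i = j then x * q - (q * x)⁻¹ else x - x⁻¹

/-- Off-diagonal weights of the six-vertex R-matrix. -/
def rOff (q : ℂ) (i j : Fin 2) : ℂ := if i = j then 0 else q - q⁻¹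

/-- The sign `ε_{ij}`. -/
def eps (i j : Fin 2) : ℂ := if i = j then 0 else if i = 0 then 1 else -1

section Algebra

variable {A B : Type*} [Ring A] [Algebra ℂ A] [Ring B] [Algebra ℂ B]

/-- The Yang-Baxter exchange relations, in components. -/
def RTT (q : ℂ) (T : ℂ → Matrix (Fin 2) (Fin 2) A) : Prop :=
  ∀ l m : ℂ, l ≠ 0 → m ≠ 0 → ∀ i j k p : Fin 2,
    rDiag q (l / m) i j • (T l i k * T m j p) + rOff q i j • (T l j k * T m i p) =
      rDiag q (l / m) k p • (T m j p * T l i k) + rOff q k p • (T m j k * T l i p)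

/-- The quantum determinant relations, in components. -/
def QDet (q : ℂ) (δ : ℂ → ℂ) (T : ℂ → Matrix (Fin 2) (Fin 2) A) : Prop :=
  ∀ l : ℂ, l ≠ 0 → ∀ i j : Fin 2,
    T l i 0 * T (l / q) j 1 - T l i 1 * T (l / q) j 0 = (eps i j * δ l) • (1 : A)

/-- Conjugation of a `2 × 2` matrix by the twist `σ^x`. -/
def flip (T : Matrix (Fin 2) (Fin 2) A) : Matrix (Fin 2) (Fin 2) A :=
  Matrix.of fun i j => T (1 - i) (1 - j)

theorem rDiag_sub (q x : ℂ) (i j : Fin 2) : rDiag q x (1 - i) (1 - j) = rDiag q x i j := by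
  fin_cases i <;> fin_cases j <;> simp [rDiag]

theorem rOff_sub (q : ℂ) (i j : Fin 2) : rOff q (1 - i) (1 - j) = rOff q i j := by
  fin_cases i <;> fin_cases j <;> simp [rOff]

theorem RTT.flip {q : ℂ} {T : ℂ → Matrix (Fin 2) (Fin 2) A} (h : RTT q T) :
    RTT q fun l => flip (T l) := by
  intro l m hl hm i j k p
  have := h l m hl hm (1 - i) (1 - j) (1 - k) (1 - p)
  simp only [rDiag_sub, rOff_sub] at this
  exact this

/-- The twist reverses the sign of ε and of the difference on the left alike, so δ is unchanged. -/
theorem QDet.flip {q : ℂ} {δ : ℂ → ℂ} {T : ℂ → Matrix (Fin 2) (Fin 2) A} (h : QDet q δ T) :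
    QDet q δ fun l => flip (T l) := by
  intro l hl i j
  have := h l hl (1 - i) (1 - j)
  have e : eps (1 - i) (1 - j) = - eps i j := by
    fin_cases i <;> fin_cases j <;> simp [eps]
  rw [e, neg_mul, neg_smul] at this
  rw [← neg_inj, ← this]
  simp [AntiXXZ.flip]

theorem RTT.map {q : ℂ} {T : ℂ → Matrix (Fin 2) (Fin 2) A} (h : RTT q T) (f : A →ₐ[ℂ] B) :
    RTT q fun l => (T l).map f := by
  intro l m hl hm i j k p
  simpa using congrArg f (h l m hl hm i j k p)

theorem QDet.map {q : ℂ} {δ : ℂ → ℂ} {T : ℂ → Matrix (Fin 2) (Fin 2) A} (h : QDet q δ T)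
    (f : A →ₐ[ℂ] B) : QDet q δ fun l => (T l).map f := by
  intro l hl i j
  simpa using congrArg f (h l hl i j)

theorem RTT.comp_div {q : ℂ} {T : ℂ → Matrix (Fin 2) (Fin 2) A} (h : RTT q T) {c : ℂ}
    (hc : c ≠ 0) : RTT q fun l => T (l / c) := by
  intro l m hl hm i j k p
  have := h (l / c) (m / c) (div_ne_zero hl hc) (div_ne_zero hm hc) i j k p
  rwa [div_div_div_cancel_right₀ hc] at this

theorem QDet.comp_div {q : ℂ} {δ : ℂ → ℂ} {T : ℂ → Matrix (Fin 2) (Fin 2) A} (h : QDet q δ T)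
    {c : ℂ} (hc : c ≠ 0) : QDet q (fun l => δ (l / c)) fun l => T (l / c) := by
  intro l hl i j
  have := h (l / c) (div_ne_zero hl hc) i j
  rwa [div_right_comm] at this

theorem RTT.one (q : ℂ) : RTT q fun _ => (1 : Matrix (Fin 2) (Fin 2) A) := by
  intro l m _ _ i j k p
  fin_cases i <;> fin_cases j <;> fin_cases k <;> fin_cases p <;>
    simp [rDiag, rOff]

theorem QDet.one (q : ℂ) : QDet q 1 fun _ => (1 : Matrix (Fin 2) (Fin 2) A) := by
  intro l _ i j
  fin_cases i <;> fin_cases j <;> simp [eps, Matrix.one_apply]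

/-- The coproduct argument: entries of Y pass those of X, so the R-matrix weights can be carried
through the X factors and then through the Y factors. -/
theorem RTT.mul {q : ℂ} {X Y : ℂ → Matrix (Fin 2) (Fin 2) A} (hX : RTT q X) (hY : RTT q Y)
    (hXY : ∀ l m i j k p, Commute (Y l i j) (X m k p)) : RTT q fun l => X l * Y l := by
  have comm : ∀ l m i j k p (z : A), Y l i j * (X m k p * z) = X m k p * (Y l i j * z) := by
    intro l m i j k p z
    rw [← mul_assoc, (hXY l m i j k p).eq, mul_assoc]
  have expand : ∀ l m i j k p, (X l * Y l) i k * (X m * Y m) j p =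
      ∑ r, ∑ s, (X l i r * X m j s) * (Y l r k * Y m s p) := by
    intro l m i j k p
    simp only [Matrix.mul_apply, Finset.sum_mul, Finset.mul_sum]
    rw [Finset.sum_comm]
    simp only [mul_assoc, comm]
  intro l m hl hm i j k p
  simp only [expand]
  calc _ = ∑ r, ∑ s, (rDiag q (l / m) i j • (X l i r * X m j s) +
            rOff q i j • (X l j r * X m i s)) * (Y l r k * Y m s p) := by
        simp only [add_mul, Finset.sum_add_distrib, smul_mul_assoc, Finset.smul_sum]
    _ = ∑ r, ∑ s, (rDiag q (l / m) r s • (X m j s * X l i r) +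
            rOff q r s • (X m j r * X l i s)) * (Y l r k * Y m s p) := by
        simp only [hX l m hl hm]
    _ = ∑ r, ∑ s, (X m j s * X l i r) * (rDiag q (l / m) r s • (Y l r k * Y m s p) +
            rOff q r s • (Y l s k * Y m r p)) := by
        simp only [add_mul, mul_add, Finset.sum_add_distrib, smul_mul_assoc, mul_smul_comm]
        congr 1
        -- In the off-diagonal term the summation indices are renamed, which is harmless because
        -- `rOff` is symmetric.
        rw [Finset.sum_comm]
        refine Finset.sum_congr rfl fun r _ => Finset.sum_congr rfl fun s _ => ?_
        have : rOff q r s = rOff q s r := by simp [rOff, eq_comm]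
        rw [this]
    _ = ∑ r, ∑ s, (X m j s * X l i r) * (rDiag q (l / m) k p • (Y m s p * Y l r k) +
            rOff q k p • (Y m s k * Y l r p)) := by
        simp only [hY l m hl hm]
    _ = _ := by
        simp only [mul_add, Finset.sum_add_distrib, mul_smul_comm, Finset.smul_sum]
        rw [Finset.sum_comm]
        congr 1
        rw [Finset.sum_comm]

theorem QDet.mul {q : ℂ} {δ δ' : ℂ → ℂ} {X Y : ℂ → Matrix (Fin 2) (Fin 2) A} (hX : QDet q δ X)
    (hY : QDet q δ' Y) (hXY : ∀ l m i j k p, Commute (Y l i j) (X m k p)) :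
    QDet q (fun l => δ l * δ' l) fun l => X l * Y l := by
  have comm : ∀ l m i j k p (z : A), Y l i j * (X m k p * z) = X m k p * (Y l i j * z) := by
    intro l m i j k p z
    rw [← mul_assoc, (hXY l m i j k p).eq, mul_assoc]
  have expand : ∀ l m i j k p, (X l * Y l) i k * (X m * Y m) j p =
      ∑ r, ∑ s, (X l i r * X m j s) * (Y l r k * Y m s p) := by
    intro l m i j k p
    simp only [Matrix.mul_apply, Finset.sum_mul, Finset.mul_sum]
    rw [Finset.sum_comm]
    simp only [mul_assoc, comm]
  intro l hl i j
  simp only [expand]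
  calc _ = ∑ r, ∑ s, (X l i r * X (l / q) j s) *
          (Y l r 0 * Y (l / q) s 1 - Y l r 1 * Y (l / q) s 0) := by
        simp only [mul_sub, Finset.sum_sub_distrib]
    _ = δ' l • (X l i 0 * X (l / q) j 1 - X l i 1 * X (l / q) j 0) := by
        simp only [hY l hl]
        simp [Fin.sum_univ_two, eps, sub_eq_add_neg]
    _ = _ := by
        rw [hX l hl, smul_smul]
        congr 1
        ring

/-- The entrywise transpose, with rows and columns exchanged. -/
def coTranspose {ι : Type*} (T : ℂ → Matrix (Fin 2) (Fin 2) (Matrix ι ι ℂ)) (l : ℂ) :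
    Matrix (Fin 2) (Fin 2) (Matrix ι ι ℂ) :=
  Matrix.of fun i j => (T l j i)ᵀ

/-- Transposition reverses products and so exchanges the two sides of the relation. It allows right
states to be handled as left states, with B and C interchanged. -/
theorem RTT.coTranspose {ι : Type*} [Fintype ι] [DecidableEq ι] {q : ℂ}
    {T : ℂ → Matrix (Fin 2) (Fin 2) (Matrix ι ι ℂ)} (h : RTT q T) : RTT q (coTranspose T) := by
  intro l m hl hm i j k p
  have := congrArg Matrix.transpose (h l m hl hm k p i j)
  simp only [Matrix.transpose_add, Matrix.transpose_smul, Matrix.transpose_mul] at this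
  simp only [AntiXXZ.coTranspose, Matrix.of_apply]
  exact this.symm

/-! ### The six-vertex Lax matrix -/

/-- The six-vertex Lax matrix, with entries acting on a single site. -/
def smallLax (q x : ℂ) : Matrix (Fin 2) (Fin 2) (Matrix (Fin 2) (Fin 2) ℂ) :=
  Matrix.of fun i j =>
    if i = j then Matrix.diagonal (rDiag q x i) else Matrix.single j i (q - q⁻¹)

theorem rtt_smallLax {q : ℂ} (hq : q ≠ 0) : RTT q (smallLax q) := by
  intro l m hl hm i j k p
  ext u v
  fin_cases i <;> fin_cases j <;> fin_cases k <;> fin_cases p <;> fin_cases u <;> fin_cases v <;>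
    simp [smallLax, rDiag, rOff, Matrix.mul_apply, Matrix.diagonal,
      Matrix.single] <;>
    first | (left; ring) | (field_simp; ring)

theorem qDet_smallLax {q : ℂ} (hq : q ≠ 0) :
    QDet q (fun x => (x * q - (q * x)⁻¹) * (x / q - (x / q)⁻¹)) (smallLax q) := by
  intro l hl i j
  ext u v
  fin_cases i <;> fin_cases j <;> fin_cases u <;> fin_cases v <;>
    simp [smallLax, rDiag, eps, Matrix.mul_apply, Matrix.diagonal,
      Matrix.single] <;>
    (field_simp; ring)

end Algebra


/-! ### Local operators -/

section Local

variable {N : ℕ}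

theorem localOp_mul_apply (X : Matrix (Fin 2) (Fin 2) ℂ) (n : Fin N) (M : Op N) (s s' : Conf N) :
    (localOp X n * M) s s' = ∑ k, X (s n) k * M (Function.update s n k) s' := by
  rw [Matrix.mul_apply]
  symm
  refine Finset.sum_of_injOn (fun k => Function.update s n k)
    (fun a _ b _ hab => Function.update_injective s n hab) (by simp) ?_ ?_
  · intro u _ hu
    rw [localOp, Matrix.of_apply, if_neg, zero_mul]
    intro h
    refine hu ⟨u n, by simp, ?_⟩
    funext m
    by_cases hm : m = n
    · subst hm; simp
    · simp [hm, h m hm]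
  · intro k _
    have : ∀ m, m ≠ n → s m = Function.update s n k m := by
      intro m hm; simp [hm]
    rw [localOp, Matrix.of_apply, if_pos this, Function.update_self]

theorem localOp_one (n : Fin N) : localOp 1 n = (1 : Op N) := by
  ext s s'
  simp only [localOp, Matrix.of_apply, Matrix.one_apply]
  by_cases h : s = s'
  · subst h; simp
  · rw [if_neg h]
    split_ifs with h1 h2
    · exact absurd (funext fun m => if hm : m = n then hm ▸ h2 else h1 m hm) h
    · rfl
    · rfl

theorem localOp_mul (X Y : Matrix (Fin 2) (Fin 2) ℂ) (n : Fin N) :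
    localOp (X * Y) n = localOp X n * localOp Y n := by
  ext s s'
  rw [localOp_mul_apply]
  have : ∀ k, (∀ m, m ≠ n → Function.update s n k m = s' m) ↔ (∀ m, m ≠ n → s m = s' m) := by
    intro k
    refine forall_congr' fun m => forall_congr' fun hm => ?_
    simp [hm]
  simp only [localOp, Matrix.of_apply, this, Matrix.mul_apply, Function.update_self]
  split_ifs <;> simp

theorem localOp_commute (X Y : Matrix (Fin 2) (Fin 2) ℂ) {n m : Fin N} (h : n ≠ m) :
    Commute (localOp X n) (localOp Y m) := by
  have key : ∀ (X Y : Matrix (Fin 2) (Fin 2) ℂ) {n m : Fin N}, n ≠ m → ∀ s s' : Conf N,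
      (localOp X n * localOp Y m) s s' =
        if ∀ p, p ≠ n → p ≠ m → s p = s' p then X (s n) (s' n) * Y (s m) (s' m) else 0 := by
    intro X Y n m h s s'
    rw [localOp_mul_apply, Finset.sum_eq_single (s' n)]
    · have : (∀ p, p ≠ m → Function.update s n (s' n) p = s' p) ↔
          ∀ p, p ≠ n → p ≠ m → s p = s' p := by
        refine ⟨fun H p hn hm => by simpa [hn] using H p hm, fun H p hm => ?_⟩
        by_cases hn : p = n
        · subst hn; simp
        · simpa [hn] using H p hn hm
      simp [localOp, this, h.symm]
    · intro k _ hk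
      have : ¬ ∀ p, p ≠ m → Function.update s n k p = s' p := fun H => hk (by simpa using H n h)
      simp [localOp, this]
    · simp
  change _ = _
  ext s s'
  rw [key X Y h, key Y X h.symm, mul_comm]
  congr 1
  exact propext ⟨fun H p a b => H p b a, fun H p a b => H p b a⟩

/-- The operators acting on site `n`, as an algebra homomorphism. -/
def localHom (n : Fin N) : Matrix (Fin 2) (Fin 2) ℂ →ₐ[ℂ] Op N :=
  AlgHom.ofLinearMap
    { toFun := fun X => localOp X n
      map_add' := fun X Y => by
        ext s s'
        simp only [localOp, Matrix.of_apply, Matrix.add_apply]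
        split_ifs <;> simp
      map_smul' := fun c X => by
        ext s s'
        simp [localOp] }
    (localOp_one n) fun X Y => localOp_mul X Y n

theorem localHom_apply (n : Fin N) (X : Matrix (Fin 2) (Fin 2) ℂ) :
    localHom n X = localOp X n := rfl

theorem lax_eq_map (q : ℂ) (n : Fin N) (x : ℂ) : lax q n x = (smallLax q x).map (localHom n) := by
  have h00 : xPlus q x • (1 : Matrix (Fin 2) (Fin 2) ℂ) + xMinus q x • !![1, 0; 0, -1] =
      smallLax q x 0 0 := by
    ext i j
    fin_cases i <;> fin_cases j <;> simp [smallLax, rDiag, xPlus, xMinus, Matrix.diagonal] <;> ring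
  have h11 : xPlus q x • (1 : Matrix (Fin 2) (Fin 2) ℂ) - xMinus q x • !![1, 0; 0, -1] =
      smallLax q x 1 1 := by
    ext i j
    fin_cases i <;> fin_cases j <;> simp [smallLax, rDiag, xPlus, xMinus, Matrix.diagonal] <;> ring
  have h01 : (q - q⁻¹) • (!![0, 0; 1, 0] : Matrix (Fin 2) (Fin 2) ℂ) = smallLax q x 0 1 := by
    ext i j
    fin_cases i <;> fin_cases j <;> simp [smallLax, Matrix.single]
  have h10 : (q - q⁻¹) • (!![0, 1; 0, 0] : Matrix (Fin 2) (Fin 2) ℂ) = smallLax q x 1 0 := by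
    ext i j
    fin_cases i <;> fin_cases j <;> simp [smallLax, Matrix.single]
  refine Matrix.ext fun i j => ?_
  rw [Matrix.map_apply]
  fin_cases i <;> fin_cases j <;>
    simp only [Fin.zero_eta, Fin.mk_one, ← h00, ← h01, ← h10, ← h11, map_add, map_sub, map_smul,
      map_one] <;> rfl

/-! ### Monodromy matrices -/

/-- The Lax matrix of site `p.1` at `l / η`, conjugated by the twist if `p.2` is true. -/
def siteLax (q : ℂ) (η : Fin N → ℂ) (p : Fin N × Bool) (l : ℂ) : Matrix (Fin 2) (Fin 2) (Op N) :=
  if p.2 then flip (lax q p.1 (l / η p.1)) else lax q p.1 (l / η p.1)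

/-- The ordered product of the (twisted) Lax matrices of a list of sites. -/
def chain (q : ℂ) (η : Fin N → ℂ) (s : List (Fin N × Bool)) (l : ℂ) :
    Matrix (Fin 2) (Fin 2) (Op N) :=
  (s.map fun p => siteLax q η p l).prod

theorem chain_cons (q : ℂ) (η : Fin N → ℂ) (p : Fin N × Bool) (s : List (Fin N × Bool)) (l : ℂ) :
    chain q η (p :: s) l = siteLax q η p l * chain q η s l := by
  simp [chain]

theorem chain_append (q : ℂ) (η : Fin N → ℂ) (s s' : List (Fin N × Bool)) (l : ℂ) :
    chain q η (s ++ s') l = chain q η s l * chain q η s' l := by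
  simp [chain]

theorem chain_nil (q : ℂ) (η : Fin N → ℂ) (l : ℂ) : chain q η [] l = 1 := by
  simp [chain]

theorem monodromy_eq_chain (q : ℂ) (η : Fin N → ℂ) (l : ℂ) :
    monodromy q η l = chain q η ((List.finRange N).reverse.map fun n => (n, false)) l := by
  rw [monodromy, chain, List.ofFn_eq_map, ← List.map_reverse, List.map_map]
  rfl

theorem siteLax_apply_eq (q : ℂ) (η : Fin N → ℂ) (p : Fin N × Bool) (l : ℂ) (i j : Fin 2) :
    ∃ X, siteLax q η p l i j = localHom p.1 X := by
  simp only [siteLax, lax_eq_map]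
  split_ifs <;> exact ⟨_, rfl⟩

theorem localHom_commute_chain (q : ℂ) (η : Fin N → ℂ) (n : Fin N) (X : Matrix (Fin 2) (Fin 2) ℂ)
    (s : List (Fin N × Bool)) (hs : n ∉ s.map Prod.fst) (l : ℂ) (i j : Fin 2) :
    Commute (localHom n X) (chain q η s l i j) := by
  induction s generalizing i j with
  | nil =>
    rw [chain_nil, Matrix.one_apply]
    split_ifs
    · exact Commute.one_right _
    · exact Commute.zero_right _
  | cons p s ih =>
    simp only [List.map_cons, List.mem_cons, not_or] at hs
    rw [chain_cons, Matrix.mul_apply]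
    refine Commute.sum_right _ _ _ fun k _ => Commute.mul_right ?_ (ih hs.2 k j)
    obtain ⟨Y, hY⟩ := siteLax_apply_eq q η p l i k
    rw [hY]
    exact localOp_commute _ _ hs.1

theorem chain_commute_siteLax (q : ℂ) (η : Fin N → ℂ) (p : Fin N × Bool)
    (s : List (Fin N × Bool)) (hs : p.1 ∉ s.map Prod.fst) (l m : ℂ) (i j k r : Fin 2) :
    Commute (chain q η s l i j) (siteLax q η p m k r) := by
  obtain ⟨Y, hY⟩ := siteLax_apply_eq q η p m k r
  rw [hY]
  exact (localHom_commute_chain q η p.1 Y s hs l i j).symm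

theorem rtt_chain {q : ℂ} (hq : q ≠ 0) {η : Fin N → ℂ} (hη : ∀ a, η a ≠ 0)
    (s : List (Fin N × Bool)) (hs : (s.map Prod.fst).Nodup) : RTT q (chain q η s) := by
  induction s with
  | nil => simpa only [funext (chain_nil q η)] using RTT.one q
  | cons p s ih =>
    rw [List.map_cons, List.nodup_cons] at hs
    have h : RTT q (siteLax q η p) := by
      have := ((rtt_smallLax hq).map (localHom p.1)).comp_div (hη p.1)
      simp only [← lax_eq_map] at this
      unfold siteLax
      split_ifs
      · exact this.flip
      · exact this
    simpa only [funext (chain_cons q η p s)] using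
      h.mul (ih hs.2) fun l m i j k r => chain_commute_siteLax q η p s hs.1 l m i j k r

theorem qDet_chain {q : ℂ} (hq : q ≠ 0) {η : Fin N → ℂ} (hη : ∀ a, η a ≠ 0)
    (s : List (Fin N × Bool)) (hs : (s.map Prod.fst).Nodup) :
    QDet q (fun l => (s.map fun p => (l / η p.1 * q - (q * (l / η p.1))⁻¹) *
      (l / η p.1 / q - (l / η p.1 / q)⁻¹)).prod) (chain q η s) := by
  induction s with
  | nil =>
    simp only [funext (chain_nil q η), List.map_nil, List.prod_nil]
    exact QDet.one q
  | cons p s ih =>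
    rw [List.map_cons, List.nodup_cons] at hs
    have h : QDet q (fun l => (l / η p.1 * q - (q * (l / η p.1))⁻¹) *
        (l / η p.1 / q - (l / η p.1 / q)⁻¹)) (siteLax q η p) := by
      have := ((qDet_smallLax hq).map (localHom p.1)).comp_div (hη p.1)
      simp only [← lax_eq_map] at this
      unfold siteLax
      split_ifs
      · exact this.flip
      · exact this
    simpa only [funext (chain_cons q η p s), List.map_cons, List.prod_cons] using
      h.mul (ih hs.2) fun l m i j k r => chain_commute_siteLax q η p s hs.1 l m i j k r

theorem map_fst_pair {α β : Type*} (s : List α) (b : β) :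
    (s.map fun n => (n, b)).map Prod.fst = s := by
  simp [List.map_map, Function.comp_def]

theorem rtt_monodromy {q : ℂ} (hq : q ≠ 0) {η : Fin N → ℂ} (hη : ∀ a, η a ≠ 0) :
    RTT q (monodromy q η) := by
  rw [funext (monodromy_eq_chain q η)]
  refine rtt_chain hq hη _ ?_
  rw [map_fst_pair, List.nodup_reverse]
  exact List.nodup_finRange N

/-- The quantum determinant does not see the order or the twisting of the sites. The minus sign
undoes the one in `aFun`. -/
theorem prod_map_qDet {q : ℂ} {η : Fin N → ℂ} (hη : ∀ a, η a ≠ 0)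
    (s : List (Fin N × Bool)) (hs : (s.map Prod.fst).Perm (List.finRange N)) (l : ℂ) :
    (s.map fun p => (l / η p.1 * q - (q * (l / η p.1))⁻¹) *
      (l / η p.1 / q - (l / η p.1 / q)⁻¹)).prod = -(aFun q η l * dFun η (l / q)) := by
  have : ∀ f : Fin N → ℂ, (s.map fun p => f p.1).prod = ∏ n, f n := by
    intro f
    rw [show (fun p : Fin N × Bool => f p.1) = f ∘ Prod.fst from rfl, ← List.map_map,
      (hs.map f).prod_eq, ← List.ofFn_eq_map, List.prod_ofFn]
  rw [this fun n => (l / η n * q - (q * (l / η n))⁻¹) * (l / η n / q - (l / η n / q)⁻¹),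
    Finset.prod_mul_distrib, aFun, dFun, neg_mul, neg_neg]
  congr 1
  · refine Finset.prod_congr rfl fun n _ => ?_
    have := hη n
    field_simp
  · refine Finset.prod_congr rfl fun n _ => ?_
    have := hη n
    field_simp

theorem qDet_monodromy {q : ℂ} (hq : q ≠ 0) {η : Fin N → ℂ} (hη : ∀ a, η a ≠ 0) :
    QDet q (fun l => -(aFun q η l * dFun η (l / q))) (monodromy q η) := by
  have hp : (((List.finRange N).reverse.map fun n => (n, false)).map Prod.fst).Perm
      (List.finRange N) := by
    rw [map_fst_pair]
    exact List.reverse_perm _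
  rw [funext (monodromy_eq_chain q η)]
  simpa only [prod_map_qDet hη _ hp] using
    qDet_chain hq hη _ (hp.nodup_iff.2 (List.nodup_finRange N))

/-- Needed to divide exchange relations by a factor that vanishes at isolated points; see
`eq_of_sub_mul_eq`. -/
theorem continuousAt_monodromy {q : ℂ} (hq : q ≠ 0) {η : Fin N → ℂ} (hη : ∀ a, η a ≠ 0) {l : ℂ}
    (hl : l ≠ 0) (i j : Fin 2) : ContinuousAt (fun x => monodromy q η x i j) l := by
  have site : ∀ n : Fin N, ∀ i j, ContinuousAt (fun x => lax q n (x / η n) i j) l := by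
    intro n i j
    have h1 : l / η n ≠ 0 := div_ne_zero hl (hη n)
    have h2 : q * (l / η n) ≠ 0 := mul_ne_zero hq h1
    have hx : ContinuousAt (fun x => x / η n) l := by fun_prop
    have hp : ContinuousAt (fun x => xPlus q (x / η n)) l := by
      unfold xPlus
      fun_prop (disch := assumption)
    have hm : ContinuousAt (fun x => xMinus q (x / η n)) l := by
      unfold xMinus
      fun_prop (disch := assumption)
    fin_cases i <;> fin_cases j
    · exact (hp.smul continuousAt_const).add (hm.smul continuousAt_const)
    · exact continuousAt_const
    · exact continuousAt_const
    · exact (hp.smul continuousAt_const).sub (hm.smul continuousAt_const)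
  simp only [monodromy_eq_chain]
  generalize (List.finRange N).reverse = s
  induction s generalizing i j with
  | nil => simpa only [List.map_nil, chain_nil] using continuousAt_const
  | cons n s ih =>
    simp only [List.map_cons, chain_cons, Matrix.mul_apply]
    exact tendsto_finsetSum _ fun k _ => (site n i k).mul (ih k j)

end Local


/-! ### The shift property of the transfer matrix -/

section Shift

variable {A : Type*} [Ring A] [Algebra ℂ A]

/-- The Lax matrix degenerates to a multiple of the permutation of auxiliary space and site. -/
theorem smallLax_one (q : ℂ) (i j : Fin 2) :
    smallLax q 1 i j = (q - q⁻¹) • Matrix.single j i 1 := by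
  ext u v
  fin_cases i <;> fin_cases j <;> fin_cases u <;> fin_cases v <;>
    simp [smallLax, rDiag, Matrix.diagonal, Matrix.single]

/-- At this point it is a multiple of the projector on the singlet of auxiliary space and site, of
rank one. -/
theorem smallLax_inv {q : ℂ} (hq : q ≠ 0) (i j : Fin 2) :
    smallLax q q⁻¹ i j =
      ((q - q⁻¹) * if i = j then -1 else 1) • Matrix.single (1 - i) (1 - j) 1 := by
  ext u v
  fin_cases i <;> fin_cases j <;> fin_cases u <;> fin_cases v <;>
    simp [smallLax, rDiag, Matrix.diagonal, Matrix.single, hq]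

theorem smallLax_eq (q x : ℂ) (i j : Fin 2) :
    smallLax q x i j = if i = j then
      rDiag q x i 0 • Matrix.single 0 0 1 + rDiag q x i 1 • Matrix.single 1 1 1
    else rOff q i j • Matrix.single j i 1 := by
  ext u v
  fin_cases i <;> fin_cases j <;> fin_cases u <;> fin_cases v <;>
    simp [smallLax, rDiag, rOff, Matrix.diagonal, Matrix.single]

variable {q : ℂ} {e : ℂ} {Z : ℂ → Matrix (Fin 2) (Fin 2) A} {φ : Matrix (Fin 2) (Fin 2) ℂ →ₐ[ℂ] A}

theorem twistedTrace_eq_sum (he : e ≠ 0) (M : ℂ → Matrix (Fin 2) (Fin 2) A)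
    (hM : ∀ l, M l = Z l * (smallLax q (l / e)).map φ) :
    M e 0 1 + M e 1 0 = (q - q⁻¹) • (Z e 0 0 * φ (Matrix.single 1 0 1) +
      Z e 0 1 * φ (Matrix.single 1 1 1) + Z e 1 0 * φ (Matrix.single 0 0 1) +
      Z e 1 1 * φ (Matrix.single 0 1 1)) := by
  simp only [hM, div_self he, Matrix.mul_apply, Fin.sum_univ_two, Matrix.map_apply, smallLax_one,
    map_smul, mul_smul_comm, smul_add]
  abel

/-- The shift property: the antiperiodic trace at `e` moves the last Lax factor to the front and
twists it. Z stands for the other sites, with which φ commutes. -/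
theorem twistedTrace_mul (he : e ≠ 0) (hZ : RTT q Z)
    (hc : ∀ x l i j, φ x * Z l i j = Z l i j * φ x) (M : ℂ → Matrix (Fin 2) (Fin 2) A)
    (hM : ∀ l, M l = Z l * (smallLax q (l / e)).map φ) {l : ℂ} (hl : l ≠ 0) (i j : Fin 2) :
    (M e 0 1 + M e 1 0) * M l i j =
      (flip ((smallLax q (l / e)).map φ) * Z l) i j * (M e 0 1 + M e 1 0) := by
  have hc' : ∀ x l i j y, φ x * (Z l i j * y) = Z l i j * (φ x * y) := by
    intro x l i j y
    rw [← mul_assoc, hc, mul_assoc]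
  have h := fun r k => hZ l e hl he i r j k
  rw [twistedTrace_eq_sum he M hM, hM, mul_smul_comm, smul_mul_assoc]
  congr 1
  set x := l / e
  -- One side of the exchange relation for Z, contracted with E_{1-r,k} at the site. This form gives
  -- the left member, and the other side of the relation gives the right member.
  trans (∑ r, ∑ k, (rDiag q x j k • (Z e r k * Z l i j) + rOff q j k • (Z e r j * Z l i k)) *
    φ (Matrix.single (1 - r) k 1))
  · fin_cases j <;>
    simp [Matrix.mul_apply, Fin.sum_univ_two, smallLax_eq, mul_add, add_mul, mul_assoc, hc',
      ← map_mul, -Matrix.smul_single, rOff] <;> abel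
  · simp only [← h]
    fin_cases i <;>
    simp [Matrix.mul_apply, flip, Fin.sum_univ_two, smallLax_eq, mul_add, add_mul, mul_assoc, hc',
      hc, ← map_mul, -Matrix.smul_single, rOff, rDiag] <;> abel

/-- The rank-one value of the Lax matrix at `e / q` leaves only the combinations of Z that form its
quantum determinant. -/
theorem twistedTrace_mul_twistedTrace (hq : q ≠ 0) (he : e ≠ 0) {δ : ℂ → ℂ} (hZ : QDet q δ Z)
    (hc : ∀ x l i j, φ x * Z l i j = Z l i j * φ x) (M : ℂ → Matrix (Fin 2) (Fin 2) A)
    (hM : ∀ l, M l = Z l * (smallLax q (l / e)).map φ) :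
    (M e 0 1 + M e 1 0) * (M (e / q) 0 1 + M (e / q) 1 0) =
      ((q - q⁻¹) * (q - q⁻¹) * δ e) • (1 : A) := by
  have hc' : ∀ x l i j y, φ x * (Z l i j * y) = Z l i j * (φ x * y) := by
    intro x l i j y
    rw [← mul_assoc, hc, mul_assoc]
  have h := hZ e he
  have hq' : e / q / e = q⁻¹ := by field_simp
  have hM' : M (e / q) 0 1 + M (e / q) 1 0 = (q - q⁻¹) • (Z (e / q) 0 0 * φ (Matrix.single 1 0 1)
      - Z (e / q) 1 0 * φ (Matrix.single 1 1 1) - Z (e / q) 0 1 * φ (Matrix.single 0 0 1)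
      + Z (e / q) 1 1 * φ (Matrix.single 0 1 1)) := by
    simp [hM, hq', Matrix.mul_apply, Fin.sum_univ_two, Matrix.map_apply, smallLax_inv hq,
      smul_add, smul_sub, -Matrix.smul_single]
    module
  rw [twistedTrace_eq_sum he M hM, hM', smul_mul_smul_comm, mul_smul _ (δ e)]
  congr 1
  -- The four combinations carry ε_{00}, ε_{01}, ε_{10}, ε_{11}. The two nonzero ones add up to
  -- E_{00} + E_{11} = 1.
  trans ((Z e 0 0 * Z (e / q) 0 1 - Z e 0 1 * Z (e / q) 0 0) * (-φ (Matrix.single 1 0 1)) +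
    (Z e 0 0 * Z (e / q) 1 1 - Z e 0 1 * Z (e / q) 1 0) * φ (Matrix.single 1 1 1) +
    (Z e 1 0 * Z (e / q) 0 1 - Z e 1 1 * Z (e / q) 0 0) * (-φ (Matrix.single 0 0 1)) +
    (Z e 1 0 * Z (e / q) 1 1 - Z e 1 1 * Z (e / q) 1 0) * φ (Matrix.single 0 1 1))
  · simp [mul_add, add_mul, sub_mul, mul_sub, mul_assoc, hc', ← map_mul, -Matrix.smul_single]
    abel
  · rw [h, h, h, h]
    have : (1 : A) = φ (Matrix.single 0 0 1) + φ (Matrix.single 1 1 1) := by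
      rw [← map_add, ← map_one φ]
      congr 1
      ext u v
      fin_cases u <;> fin_cases v <;> simp [Matrix.single]
    simp only [smul_mul_assoc, one_mul]
    rw [this, smul_add]
    simp [eps]
    abel

theorem single_mul_twistedTrace (he : e ≠ 0)
    (hc : ∀ x l i j, φ x * Z l i j = Z l i j * φ x) (M : ℂ → Matrix (Fin 2) (Fin 2) A)
    (hM : ∀ l, M l = Z l * (smallLax q (l / e)).map φ) :
    φ (Matrix.single 1 0 1) * (M e 0 1 + M e 1 0) = M e 1 1 := by
  have hc' : ∀ x l i j y, φ x * (Z l i j * y) = Z l i j * (φ x * y) := by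
    intro x l i j y
    rw [← mul_assoc, hc, mul_assoc]
  rw [twistedTrace_eq_sum he M hM, hM]
  simp [div_self he, Matrix.mul_apply, Fin.sum_univ_two, Matrix.map_apply, smallLax_one,
    mul_add, hc', ← map_mul, -Matrix.smul_single, smul_add]

end Shift


/-! ### Reconstruction of local operators -/

section Reconstruction

variable {N : ℕ} {q : ℂ} {η : Fin N → ℂ}

/-- The sites of `pre`, twisted, followed by those of `post`; the order of the product is reversed
in each block. -/
def shiftedSites (pre post : List (Fin N)) : List (Fin N × Bool) :=
  (pre.reverse.map fun n => (n, true)) ++ post.reverse.map fun n => (n, false)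

theorem map_fst_shiftedSites (pre post : List (Fin N)) :
    (shiftedSites pre post).map Prod.fst = pre.reverse ++ post.reverse := by
  rw [shiftedSites, List.map_append, map_fst_pair, map_fst_pair]

theorem perm_shiftedSites (pre post : List (Fin N)) :
    ((shiftedSites pre post).map Prod.fst).Perm (pre ++ post) := by
  rw [map_fst_shiftedSites]
  exact (List.reverse_perm _).append (List.reverse_perm _)

theorem chain_shiftedSites_cons (pre post : List (Fin N)) (i : Fin N) (l : ℂ) :
    chain q η (shiftedSites pre (i :: post)) l =
      chain q η (shiftedSites pre post) l * (smallLax q (l / η i)).map (localHom i) := by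
  rw [shiftedSites, List.reverse_cons, List.map_append, ← List.append_assoc, chain_append,
    ← shiftedSites]
  simp [chain, siteLax, lax_eq_map]

theorem chain_shiftedSites_concat (pre post : List (Fin N)) (i : Fin N) (l : ℂ) :
    chain q η (shiftedSites (pre ++ [i]) post) l =
      flip ((smallLax q (l / η i)).map (localHom i)) * chain q η (shiftedSites pre post) l := by
  rw [shiftedSites, List.reverse_append, List.reverse_singleton, List.singleton_append,
    List.map_cons, List.cons_append, chain_cons, ← shiftedSites, siteLax, if_pos rfl, lax_eq_map]

theorem nodup_of_append_eq {pre post : List (Fin N)} {i : Fin N}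
    (h : pre ++ i :: post = List.finRange N) :
    i ∉ (shiftedSites pre post).map Prod.fst ∧ ((shiftedSites pre post).map Prod.fst).Nodup := by
  have h1 : (i :: (pre ++ post)).Nodup := by
    rw [← List.perm_middle.nodup_iff, h]
    exact List.nodup_finRange N
  rw [List.nodup_cons] at h1
  rw [(perm_shiftedSites pre post).mem_iff, (perm_shiftedSites pre post).nodup_iff]
  exact h1

theorem localHom_mul_chain {pre post : List (Fin N)} {i : Fin N}
    (h : pre ++ i :: post = List.finRange N) (X : Matrix (Fin 2) (Fin 2) ℂ) (l : ℂ) (j k : Fin 2) :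
    localHom i X * chain q η (shiftedSites pre post) l j k =
      chain q η (shiftedSites pre post) l j k * localHom i X :=
  localHom_commute_chain q η i X _ (nodup_of_append_eq h).1 l j k

/-- The product of the transfer matrices at the inhomogeneities of a list of sites. -/
def transferProd (q : ℂ) (η : Fin N → ℂ) (pre : List (Fin N)) : Op N :=
  (pre.map fun i => transfer q η (η i)).prod

theorem transferProd_concat (pre : List (Fin N)) (i : Fin N) :
    transferProd q η (pre ++ [i]) = transferProd q η pre * transfer q η (η i) := by
  simp [transferProd]

/-- Iteration of the shift: each transfer matrix moves one more site from the right end of the chain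
to the left end, twisted. -/
theorem transferProd_mul_monodromy (hq : q ≠ 0) (hη : ∀ a, η a ≠ 0) (pre post : List (Fin N))
    (h : pre ++ post = List.finRange N) {l : ℂ} (hl : l ≠ 0) (j k : Fin 2) :
    transferProd q η pre * monodromy q η l j k =
      chain q η (shiftedSites pre post) l j k * transferProd q η pre := by
  induction pre using List.reverseRecOn generalizing post l j k with
  | nil =>
    rw [List.nil_append] at h
    subst h
    simp [transferProd, shiftedSites, monodromy_eq_chain]
  | append_singleton pre i ih =>
    rw [List.append_assoc, List.singleton_append] at h
    have hT : transferProd q η pre * transfer q η (η i) =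
        (chain q η (shiftedSites pre (i :: post)) (η i) 0 1 +
          chain q η (shiftedSites pre (i :: post)) (η i) 1 0) * transferProd q η pre := by
      rw [transfer, opB, opC, mul_add, ih _ h (hη i), ih _ h (hη i), add_mul]
    have hU := twistedTrace_mul (hη i) (rtt_chain hq hη _ (nodup_of_append_eq h).2)
      (localHom_mul_chain h) _ (chain_shiftedSites_cons pre post i) hl j k
    rw [transferProd_concat, hT, mul_assoc, ih _ h hl, ← mul_assoc, hU, chain_shiftedSites_concat,
      mul_assoc]

theorem transferProd_mul_transfer (hq : q ≠ 0) (hη : ∀ a, η a ≠ 0) (pre post : List (Fin N))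
    (h : pre ++ post = List.finRange N) {l : ℂ} (hl : l ≠ 0) :
    transferProd q η pre * transfer q η l =
      (chain q η (shiftedSites pre post) l 0 1 + chain q η (shiftedSites pre post) l 1 0) *
        transferProd q η pre := by
  rw [transfer, opB, opC, mul_add, transferProd_mul_monodromy hq hη pre post h hl,
    transferProd_mul_monodromy hq hη pre post h hl, add_mul]

/-- Solution of the inverse problem: once the sites before `i` are shifted away, site `i` is the
last factor and `single_mul_twistedTrace` applies. -/
theorem sigmaMinus_mul_transferProd (hq : q ≠ 0) (hη : ∀ a, η a ≠ 0) (pre post : List (Fin N))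
    (i : Fin N) (h : pre ++ i :: post = List.finRange N) :
    sigmaMinus i * transferProd q η (pre ++ [i]) =
      transferProd q η pre * monodromy q η (η i) 1 1 := by
  have hs : sigmaMinus i = localHom i (Matrix.single 1 0 1) := by
    rw [localHom_apply, sigmaMinus]
    congr 1
    ext u v
    fin_cases u <;> fin_cases v <;> simp [Matrix.single]
  rw [transferProd_concat, transferProd_mul_transfer hq hη pre _ h (hη i), ← mul_assoc, hs,
    single_mul_twistedTrace (hη i) (localHom_mul_chain h) _ (chain_shiftedSites_cons pre post i),
    transferProd_mul_monodromy hq hη pre _ h (hη i)]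

/-- The prefix is kept on both sides, since it is cancelled only through its eigenvalue on an
eigenvector. -/
theorem transferProd_mul_transfer_mul_transfer (hq : q ≠ 0) (hη : ∀ a, η a ≠ 0)
    (pre post : List (Fin N)) (i : Fin N) (h : pre ++ i :: post = List.finRange N) :
    transferProd q η pre * transfer q η (η i) * transfer q η (η i / q) =
      (aFun q η (η i) * dFun η (η i / q)) • transferProd q η pre := by
  rw [transferProd_mul_transfer hq hη pre _ h (hη i), mul_assoc,
    transferProd_mul_transfer hq hη pre _ h (div_ne_zero (hη i) hq), ← mul_assoc,
    twistedTrace_mul_twistedTrace hq (hη i) (qDet_chain hq hη _ (nodup_of_append_eq h).2)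
      (localHom_mul_chain h) _ (chain_shiftedSites_cons pre post i), smul_mul_assoc, one_mul]
  congr 1
  -- With site `i` restored, the quantum determinant runs over all sites. At λ = η_i that site
  -- contributes (q - 1/q)(1/q - q), the scalar found above up to sign.
  have hp : ((shiftedSites pre post ++ [(i, false)]).map Prod.fst).Perm (List.finRange N) := by
    rw [List.map_append, ← h]
    exact ((perm_shiftedSites pre post).append_right _).trans
      (by simpa using (List.perm_append_singleton i post).append_left pre)
  have := prod_map_qDet (q := q) hη _ hp (η i)
  rw [List.map_append, List.prod_append] at this
  rw [← neg_inj, ← this]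
  simp [div_self (hη i)]
  ring

theorem transferProd_mulVec {t : ℂ → ℂ} {R : Vec N} (hη : ∀ a, η a ≠ 0)
    (hR : ∀ l : ℂ, l ≠ 0 → transfer q η l *ᵥ R = t l • R) (pre : List (Fin N)) :
    transferProd q η pre *ᵥ R = (pre.map fun i => t (η i)).prod • R := by
  induction pre with
  | nil => simp [transferProd]
  | cons i pre ih =>
    rw [transferProd, List.map_cons, List.prod_cons, ← transferProd, ← Matrix.mulVec_mulVec, ih,
      Matrix.mulVec_smul, hR _ (hη i), smul_smul, List.map_cons, List.prod_cons, mul_comm]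

theorem vecMul_transferProd {t : ℂ → ℂ} {L : Vec N} (hη : ∀ a, η a ≠ 0)
    (hL : ∀ l : ℂ, l ≠ 0 → L ᵥ* transfer q η l = t l • L) (pre : List (Fin N)) :
    L ᵥ* transferProd q η pre = (pre.map fun i => t (η i)).prod • L := by
  induction pre with
  | nil => simp [transferProd]
  | cons i pre ih =>
    rw [transferProd, List.map_cons, List.prod_cons, ← transferProd, ← Matrix.vecMul_vecMul,
      hL _ (hη i), Matrix.smul_vecMul, ih, smul_smul, List.map_cons, List.prod_cons]

theorem finRange_split (n : Fin N) :
    (List.finRange N).take n ++ n :: (List.finRange N).drop (n + 1) = List.finRange N := by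
  have := List.drop_eq_getElem_cons (l := List.finRange N) (i := n) (by simp)
  rw [List.getElem_finRange] at this
  conv_rhs => rw [← List.take_append_drop n (List.finRange N), this]
  rfl

theorem prod_map_take_finRange (f : Fin N → ℂ) (n : Fin N) :
    (((List.finRange N).take n).map f).prod = ∏ h ∈ Finset.Iio n, f h := by
  rw [← List.prod_toFinset f ((List.nodup_finRange N).sublist (List.take_sublist _ _))]
  congr 1
  ext a
  simp only [List.mem_toFinset, List.mem_take_iff_getElem, Finset.mem_Iio, List.getElem_finRange]
  constructor
  · rintro ⟨i, hi, rfl⟩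
    rw [Fin.lt_def]
    exact (lt_min_iff.1 hi).1
  · intro ha
    exact ⟨a, by simpa using ha, rfl⟩

/-- Strong induction on the site: the relations at the earlier sites force their eigenvalues to be
nonzero, so the eigenvalue of the prefix can be cancelled. -/
theorem eigenvalue_mul_eigenvalue (hq : q ≠ 0) (hη : ∀ a, η a ≠ 0)
    (hne : ∀ a, aFun q η (η a) * dFun η (η a / q) ≠ 0) {t : ℂ → ℂ} {R : Vec N} (hR0 : R ≠ 0)
    (hR : ∀ l : ℂ, l ≠ 0 → transfer q η l *ᵥ R = t l • R) (n : Fin N) :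
    t (η n) * t (η n / q) = aFun q η (η n) * dFun η (η n / q) := by
  induction n using WellFoundedLT.induction with
  | _ n ih =>
  set c := ∏ h ∈ Finset.Iio n, t (η h) with hc
  have hc0 : c ≠ 0 := Finset.prod_ne_zero_iff.2 fun h hh => by
    have := hne h
    rw [← ih h (Finset.mem_Iio.1 hh)] at this
    exact left_ne_zero_of_mul this
  have h := congrArg (· *ᵥ R) (transferProd_mul_transfer_mul_transfer hq hη _ _ n (finRange_split n))
  simp only [← Matrix.mulVec_mulVec, Matrix.smul_mulVec, hR _ (hη n), hR _ (div_ne_zero (hη n) hq),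
    Matrix.mulVec_smul, transferProd_mulVec hη hR, prod_map_take_finRange (fun i => t (η i)),
    smul_smul, ← hc] at h
  have h' := smul_left_injective ℂ hR0 h
  refine mul_right_cancel₀ hc0 ?_
  rw [← h']
  ring

/-- The matrix elements of `σ_n^-` between eigenstates of the transfer matrix reduce to those of
the lower right entry of the monodromy matrix. -/
theorem dotProduct_sigmaMinus (hq : q ≠ 0) (hη : ∀ a, η a ≠ 0)
    (hne : ∀ a, aFun q η (η a) * dFun η (η a / q) ≠ 0) {t t' : ℂ → ℂ} {L R : Vec N}
    (hL : IsLeftEigenstate q η t L) (hR : IsRightEigenstate q η t' R) (n : Fin N) :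
    L ⬝ᵥ (sigmaMinus n *ᵥ R) =
      (∏ h ∈ Finset.Iio n, t (η h)) * (∏ h ∈ Finset.Iic n, t' (η h / q)) /
        (∏ h ∈ Finset.Iic n, aFun q η (η h) * dFun η (η h / q)) *
      (L ⬝ᵥ (monodromy q η (η n) 1 1 *ᵥ R)) := by
  have hprod : ((((List.finRange N).take n) ++ [n]).map fun i => t' (η i)).prod =
      ∏ h ∈ Finset.Iic n, t' (η h) := by
    rw [List.map_append, List.prod_append, prod_map_take_finRange, ← Finset.Iio_insert,
      Finset.prod_insert Finset.notMem_Iio_self, mul_comm]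
    simp
  have h := congrArg (fun M => L ⬝ᵥ (M *ᵥ R))
    (sigmaMinus_mul_transferProd hq hη _ _ n (finRange_split n))
  simp only [← Matrix.mulVec_mulVec, transferProd_mulVec hη hR.2, hprod, Matrix.mulVec_smul,
    dotProduct_smul] at h
  rw [Matrix.dotProduct_mulVec _ (transferProd q η _), vecMul_transferProd hη hL.2,
    prod_map_take_finRange (fun i => t (η i)), smul_dotProduct, smul_eq_mul, smul_eq_mul] at h
  have h1 : ∏ h ∈ Finset.Iic n, aFun q η (η h) * dFun η (η h / q) =
      (∏ h ∈ Finset.Iic n, t' (η h)) * ∏ h ∈ Finset.Iic n, t' (η h / q) := by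
    rw [← Finset.prod_mul_distrib]
    exact Finset.prod_congr rfl fun h _ => (eigenvalue_mul_eigenvalue hq hη hne hR.1 hR.2 h).symm
  have h2 : ∏ h ∈ Finset.Iic n, aFun q η (η h) * dFun η (η h / q) ≠ 0 :=
    Finset.prod_ne_zero_iff.2 fun h _ => hne h
  rw [div_mul_eq_mul_div, eq_div_iff h2, h1, mul_right_comm, ← h]
  ring

end Reconstruction


/-! ### Separation of variables -/

section Sov

open Filter Topology

variable {N : ℕ} {q : ℂ} {η : Fin N → ℂ} {ι : Type*} [Fintype ι] [DecidableEq ι]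

theorem conf_induction {P : Conf N → Prop} (h0 : P 0)
    (hs : ∀ h a, h a = 0 → P h → P (Function.update h a 1)) (h : Conf N) : P h := by
  induction hn : ∑ a, (h a : ℕ) using Nat.strong_induction_on generalizing h with
  | _ n ih =>
  by_cases hz : h = 0
  · exact hz ▸ h0
  · obtain ⟨a, ha⟩ : ∃ a, h a ≠ 0 := by
      by_contra! hc
      exact hz (funext hc)
    have ha1 : h a = 1 := by omega
    have hu : h = Function.update (Function.update h a 0) a 1 := by
      rw [Function.update_idem, ← ha1, Function.update_eq_self]
    rw [hu]
    refine hs _ a (by simp) (ih _ ?_ _ rfl)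
    rw [← hn]
    refine Finset.sum_lt_sum (fun b _ => ?_) ⟨a, Finset.mem_univ a, by simp [ha1]⟩
    by_cases hb : b = a
    · subst hb; simp
    · simp [hb]

/-- The factor vanishes only at ±e, and continuity extends the equality to these two points. -/
theorem eq_of_sub_mul_eq {f g : ℂ → ℂ} (hf : ∀ l ≠ 0, ContinuousAt f l)
    (hg : ∀ l ≠ 0, ContinuousAt g l) {e : ℂ} (he : e ≠ 0)
    (h : ∀ l ≠ 0, (l / e - e / l) * f l = (l / e - e / l) * g l) {l : ℂ} (hl : l ≠ 0) :
    f l = g l := by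
  have key : ∀ x ≠ 0, x ^ 2 ≠ e ^ 2 → f x = g x := by
    intro x hx hxe
    refine mul_left_cancel₀ ?_ (h x hx)
    rw [div_sub_div _ _ he hx]
    refine div_ne_zero ?_ (mul_ne_zero he hx)
    rw [← sq, ← sq]
    exact sub_ne_zero.2 hxe
  by_cases hle : l ^ 2 = e ^ 2
  · have hne : l ≠ -l := fun hc => hl (self_eq_neg.1 hc)
    have h1 : f =ᶠ[𝓝[≠] l] g := by
      filter_upwards [nhdsWithin_le_nhds (isOpen_ne.mem_nhds hl),
        nhdsWithin_le_nhds (isOpen_ne.mem_nhds hne), self_mem_nhdsWithin] with x hx hx' hxl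
      refine key x hx fun hc => ?_
      rw [← hle, sq_eq_sq_iff_eq_or_eq_neg] at hc
      exact hc.elim hxl hx'
    exact tendsto_nhds_unique (((hf l hl).tendsto.mono_left nhdsWithin_le_nhds).congr' h1)
      ((hg l hl).tendsto.mono_left nhdsWithin_le_nhds)
  · exact key l hl hle

theorem node_zero {h : Conf N} {a : Fin N} (ha : h a = 0) : node q η h a = η a := by
  simp [node, ha]

theorem node_one {h : Conf N} {a : Fin N} (ha : h a = 1) : node q η h a = η a / q := by
  simp [node, ha, div_eq_mul_inv]

theorem node_update {h : Conf N} {a b : Fin N} (hb : b ≠ a) (v : Fin 2) :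
    node q η (Function.update h a v) b = node q η h b := by
  simp [node, hb]

theorem node_ne_zero (hq : q ≠ 0) (hη : ∀ a, η a ≠ 0) (h : Conf N) (a : Fin N) :
    node q η h a ≠ 0 :=
  mul_ne_zero (hη a) (zpow_ne_zero _ hq)

/-- The eigenvalue of the lower right entry of the monodromy matrix on a separated state. -/
def dNode (q : ℂ) (η : Fin N → ℂ) (h : Conf N) (l : ℂ) : ℂ :=
  ∏ a, (l / node q η h a - node q η h a / l)

/-- The factors of `dNode` other than that of site `a`. -/
def dRest (q : ℂ) (η : Fin N → ℂ) (h : Conf N) (a : Fin N) (l : ℂ) : ℂ :=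
  ∏ b ∈ Finset.univ.erase a, (l / node q η h b - node q η h b / l)

theorem dNode_eq (h : Conf N) (a : Fin N) (l : ℂ) :
    dNode q η h l = (l / node q η h a - node q η h a / l) * dRest q η h a l :=
  (Finset.mul_prod_erase _ _ (Finset.mem_univ a)).symm

theorem dRest_update (h : Conf N) (a : Fin N) (v : Fin 2) (l : ℂ) :
    dRest q η (Function.update h a v) a l = dRest q η h a l :=
  Finset.prod_congr rfl fun b hb => by rw [node_update (Finset.ne_of_mem_erase hb)]

theorem dNode_self (hη : ∀ a, η a ≠ 0) {h : Conf N} {a : Fin N} (ha : h a = 0) :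
    dNode q η h (η a) = 0 := by
  rw [dNode_eq h a, node_zero ha, div_self (hη a), sub_self, zero_mul]

theorem continuousAt_dNode (hq : q ≠ 0) (hη : ∀ a, η a ≠ 0) (h : Conf N) {l : ℂ} (hl : l ≠ 0) :
    ContinuousAt (dNode q η h) l := by
  unfold dNode
  have := node_ne_zero hq hη h
  fun_prop (disch := first | assumption | exact this _)

theorem continuousAt_dRest (hq : q ≠ 0) (hη : ∀ a, η a ≠ 0) (h : Conf N) (a : Fin N) {l : ℂ}
    (hl : l ≠ 0) : ContinuousAt (dRest q η h a) l := by
  unfold dRest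
  have := node_ne_zero hq hη h
  fun_prop (disch := first | assumption | exact this _)

/-- A family of covectors generated from a reference covector by the lower left entry of a
monodromy matrix at the inhomogeneities. -/
structure IsSov (q : ℂ) (η : Fin N → ℂ) (γ : Fin N → ℂ)
    (T : ℂ → Matrix (Fin 2) (Fin 2) (Matrix ι ι ℂ)) (u : Conf N → ι → ℂ) : Prop where
  rtt : RTT q T
  continuousAt : ∀ l ≠ 0, ∀ i j, ContinuousAt (fun x => T x i j) l
  zero_B : ∀ l ≠ 0, u 0 ᵥ* T l 0 1 = 0
  zero_D : ∀ l ≠ 0, u 0 ᵥ* T l 1 1 = dFun η l • u 0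
  update : ∀ h a, h a = 0 → u (Function.update h a 1) = γ a • (u h ᵥ* T (η a) 1 0)

theorem continuousAt_vecMul_dotProduct {κ : Type*} [Fintype κ] {M : ℂ → Matrix κ κ ℂ} {l : ℂ}
    (hM : ContinuousAt M l) (u v : κ → ℂ) : ContinuousAt (fun x => u ᵥ* M x ⬝ᵥ v) l := by
  have hM' : ∀ i j, ContinuousAt (fun x => M x i j) l := fun i j =>
    (continuous_apply_apply i j).continuousAt.comp (f := M) hM
  simp only [dotProduct, Matrix.vecMul]
  fun_prop

variable {γ : Fin N → ℂ} {T : ℂ → Matrix (Fin 2) (Fin 2) (Matrix ι ι ℂ)} {u : Conf N → ι → ℂ}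

/-- When D(λ) is moved past C(η_a), the unwanted term contains D(η_a), which vanishes on `u h` when
h_a = 0. The ratio of weights that remains moves the zero of the eigenvalue from η_a to η_a/q. -/
theorem IsSov.vecMul_D (hS : IsSov q η γ T u) (hq : q ≠ 0) (hη : ∀ a, η a ≠ 0) (h : Conf N)
    {l : ℂ} (hl : l ≠ 0) : u h ᵥ* T l 1 1 = dNode q η h l • u h := by
  induction h using conf_induction generalizing l with
  | h0 =>
    rw [hS.zero_D l hl]
    congr 1
    simp [dFun, dNode, node]
  | hs h a ha ih =>
    rw [hS.update h a ha, Matrix.smul_vecMul, smul_comm]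
    congr 1
    refine dotProduct_eq _ _ fun v => ?_
    -- The exchange relation determines the action only after multiplication by λ/η_a - η_a/λ.
    refine eq_of_sub_mul_eq (f := fun l => u h ᵥ* T (η a) 1 0 ᵥ* T l 1 1 ⬝ᵥ v)
      (g := fun l => (dNode q η (Function.update h a 1) l • (u h ᵥ* T (η a) 1 0)) ⬝ᵥ v)
      (fun l hl => continuousAt_vecMul_dotProduct (hS.continuousAt l hl 1 1) _ _)
      (fun l hl => ?_) (hη a) (fun l hl => ?_) hl
    · simp only [smul_dotProduct]
      exact (continuousAt_dNode hq hη _ hl).smul continuousAt_const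
    · have h1 := congrArg (fun M => u h ᵥ* M ⬝ᵥ v) (hS.rtt l (η a) hl (hη a) 1 1 1 0)
      simp only [Matrix.vecMul_add, Matrix.vecMul_smul, ← Matrix.vecMul_vecMul, ih hl, ih (hη a),
        dNode_self hη ha, rDiag, rOff, Matrix.smul_vecMul, zero_smul] at h1
      simp only [smul_dotProduct, smul_eq_mul]
      rw [dNode_eq _ a, dRest_update, node_one (by simp)]
      simp [-Matrix.vecMul_vecMul, dNode_eq h a, node_zero ha] at h1
      rw [← h1, div_div_eq_mul_div]
      ring

/-- In the exchange of B(η_a) with C(η_b) both D A terms begin with a D that vanishes on `u h`, so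
B(η_a) passes through every raising step at another site. -/
theorem IsSov.vecMul_B (hS : IsSov q η γ T u) (hq : q ≠ 0) (hη : ∀ a, η a ≠ 0)
    (hsep : ∀ a b, a ≠ b → η a ^ 2 ≠ η b ^ 2) (h : Conf N)
    {a : Fin N} (ha : h a = 0) : u h ᵥ* T (η a) 0 1 = 0 := by
  induction h using conf_induction with
  | h0 => exact hS.zero_B _ (hη a)
  | hs h b hb ih =>
    have hab : a ≠ b := fun hc => by
      subst hc
      simp at ha
    rw [Function.update_of_ne hab] at ha
    have h1 := congrArg (fun M => u h ᵥ* M) (hS.rtt (η a) (η b) (hη a) (hη b) 0 1 1 0)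
    simp only [Matrix.vecMul_add, Matrix.vecMul_smul, ← Matrix.vecMul_vecMul, ih ha,
      hS.vecMul_D hq hη h (hη a), hS.vecMul_D hq hη h (hη b), dNode_self hη ha, dNode_self hη hb,
      zero_smul, Matrix.zero_vecMul, smul_zero, add_zero] at h1
    rw [hS.update h b hb, Matrix.smul_vecMul]
    have h2 : rDiag q (η a / η b) 1 0 ≠ 0 := by
      have h3 := sub_ne_zero.2 (hsep a b hab)
      have h4 : rDiag q (η a / η b) 1 0 = (η a ^ 2 - η b ^ 2) / (η a * η b) := by
        have := hη a
        have := hη b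
        simp [rDiag]
        field_simp
      rw [h4]
      exact div_ne_zero h3 (mul_ne_zero (hη a) (hη b))
    rw [(smul_eq_zero.1 h1.symm).resolve_left h2, smul_zero]

/-- The action of the antiperiodic transfer matrix on a separated covector. -/
theorem IsSov.vecMul_transfer (hS : IsSov q η γ T u) (hq : q ≠ 0) (hη : ∀ a, η a ≠ 0)
    (hsep : ∀ a b, a ≠ b → η a ^ 2 ≠ η b ^ 2) (h : Conf N)
    {a : Fin N} (ha : h a = 0) :
    u (Function.update h a 1) = γ a • (u h ᵥ* (T (η a) 0 1 + T (η a) 1 0)) := by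
  rw [hS.update h a ha, Matrix.vecMul_add, hS.vecMul_B hq hη hsep h ha, zero_add]

/-- At a site where the labels differ, one state is raised by an operator that annihilates the
other. -/
theorem dotProduct_eq_zero_of_sov {γ' : Fin N → ℂ} {v : Conf N → ι → ℂ} (hS : IsSov q η γ T u)
    (hS' : IsSov q η γ' (coTranspose T) v) (hq : q ≠ 0) (hη : ∀ a, η a ≠ 0)
    (hsep : ∀ a b, a ≠ b → η a ^ 2 ≠ η b ^ 2) {h k : Conf N} (hhk : h ≠ k) :
    u h ⬝ᵥ v k = 0 := by
  have upd : ∀ (h : Conf N) a, h a = 1 →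
      Function.update (Function.update h a 0) a 1 = h := fun h a ha => by
    rw [Function.update_idem, ← ha, Function.update_eq_self]
  obtain ⟨a, ha⟩ := Function.ne_iff.1 hhk
  by_cases h0 : h a = 0
  · have hk : k a = 1 := by omega
    rw [← upd k a hk, hS'.update _ a (by simp), dotProduct_smul, coTranspose, Matrix.of_apply,
      Matrix.vecMul_transpose, Matrix.dotProduct_mulVec, hS.vecMul_B hq hη hsep h h0,
      zero_dotProduct, smul_zero]
  · have hh : h a = 1 := by omega
    have hk : k a = 0 := by omega
    have := hS'.vecMul_B hq hη hsep k hk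
    rw [coTranspose, Matrix.of_apply, Matrix.vecMul_transpose] at this
    rw [← upd h a hh, hS.update _ a (by simp), smul_dotProduct, ← Matrix.dotProduct_mulVec, this,
      dotProduct_zero, smul_zero]

/-- The norm recursion: C B is exchanged for D A, and the quantum determinant evaluates A. -/
theorem dotProduct_update_of_sov {γ' : Fin N → ℂ} {v : Conf N → ι → ℂ} {δ : ℂ → ℂ}
    (hS : IsSov q η γ T u) (hS' : IsSov q η γ' (coTranspose T) v) (hδ : QDet q δ T) (hq : q ≠ 0)
    (hη : ∀ a, η a ≠ 0) (hsep : ∀ a b, a ≠ b → η a ^ 2 ≠ η b ^ 2) {h : Conf N} {a : Fin N}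
    (ha : h a = 0) :
    u (Function.update h a 1) ⬝ᵥ v (Function.update h a 1) * dNode q η h (η a / q) =
      γ a * γ' a * (q - q⁻¹) * dRest q η h a (η a) * δ (η a) * (u h ⬝ᵥ v h) := by
  have hD : ∀ l ≠ 0, T l 1 1 *ᵥ v h = dNode q η h l • v h := by
    intro l hl
    have := hS'.vecMul_D hq hη h hl
    rwa [coTranspose, Matrix.of_apply, Matrix.vecMul_transpose] at this
  have hC : T (η a) 1 0 *ᵥ v h = 0 := by
    have := hS'.vecMul_B hq hη hsep h ha
    rwa [coTranspose, Matrix.of_apply, Matrix.vecMul_transpose] at this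
  -- The argument of B is left free at first: the exchange relation is trivial at λ = η_a, and its
  -- value there is reached by continuity.
  have h1 : ∀ l ≠ 0, u h ᵥ* T (η a) 1 0 ᵥ* T l 0 1 ⬝ᵥ v h =
      (q - q⁻¹) * (dRest q η h a l * (u h ᵥ* T (η a) 0 0 ⬝ᵥ v h)) := by
    intro l hl
    refine eq_of_sub_mul_eq (f := fun l => u h ᵥ* T (η a) 1 0 ᵥ* T l 0 1 ⬝ᵥ v h)
      (g := fun l => (q - q⁻¹) * (dRest q η h a l * (u h ᵥ* T (η a) 0 0 ⬝ᵥ v h)))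
      (fun l hl => continuousAt_vecMul_dotProduct (hS.continuousAt l hl 0 1) _ _)
      (fun l hl => ?_) (hη a) (fun l hl => ?_) hl
    · have := continuousAt_dRest hq hη h a hl
      fun_prop
    · have h1 := congrArg (fun M => u h ᵥ* M ⬝ᵥ v h) (hS.rtt l (η a) hl (hη a) 0 1 1 0)
      simp only [Matrix.vecMul_add, Matrix.vecMul_smul, ← Matrix.vecMul_vecMul,
        hS.vecMul_D hq hη h hl, hS.vecMul_D hq hη h (hη a), dNode_self hη ha, zero_smul,
        Matrix.zero_vecMul, smul_zero, add_zero, add_dotProduct, smul_dotProduct, smul_eq_mul,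
        Matrix.smul_vecMul, ← Matrix.dotProduct_mulVec _ (T (η a) 1 0), hC, dotProduct_zero,
        mul_zero, zero_add] at h1
      rw [dNode_eq h a, node_zero ha] at h1
      simp [rDiag, rOff, -Matrix.vecMul_vecMul] at h1
      linear_combination -h1
  -- In the quantum determinant A D - B C the B C term drops because `u h` is annihilated by B(η_a).
  have h2 : dNode q η h (η a / q) * (u h ᵥ* T (η a) 0 0 ⬝ᵥ v h) = δ (η a) * (u h ⬝ᵥ v h) := by
    have h2 := congrArg (fun M => u h ᵥ* M ⬝ᵥ v h) (hδ (η a) (hη a) 0 1)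
    simp only [Matrix.vecMul_sub, ← Matrix.vecMul_vecMul, hS.vecMul_B hq hη hsep h ha,
      Matrix.zero_vecMul, sub_zero, Matrix.vecMul_smul, Matrix.vecMul_one, smul_dotProduct] at h2
    rw [← Matrix.dotProduct_mulVec, hD _ (div_ne_zero (hη a) hq)] at h2
    simpa [eps] using h2
  have h3 : u (Function.update h a 1) ⬝ᵥ v (Function.update h a 1) =
      γ a * γ' a * (u h ᵥ* T (η a) 1 0 ᵥ* T (η a) 0 1 ⬝ᵥ v h) := by
    rw [hS.update h a ha, hS'.update h a ha, coTranspose, Matrix.of_apply, Matrix.vecMul_transpose,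
      smul_dotProduct, dotProduct_smul, Matrix.dotProduct_mulVec]
    simp only [smul_eq_mul]
    ring
  rw [h3, h1 _ (hη a)]
  linear_combination (γ a * γ' a * (q - q⁻¹) * dRest q η h a (η a)) * h2

end Sov


/-! ### The separated basis of the monodromy matrix -/

section Reference

variable {N : ℕ} {q : ℂ} {η : Fin N → ℂ}

theorem refState_vecMul_localHom (n : Fin N) {X : Matrix (Fin 2) (Fin 2) ℂ} (hX : X 0 1 = 0) :
    refState N ᵥ* localHom n X = X 0 0 • refState N := by
  ext s
  rw [refState, Matrix.single_one_vecMul, localHom_apply, localOp]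
  by_cases hs : s = 0
  · subst hs; simp
  · simp only [Matrix.row_apply, Matrix.of_apply, Pi.smul_apply, Pi.single_eq_of_ne hs, smul_zero]
    split_ifs with h
    · have : s n ≠ 0 := fun hn => hs (funext fun m => by
        by_cases hm : m = n
        · subst hm; simpa using hn
        · exact (h m hm).symm)
      have : s n = 1 := by omega
      simp [this, hX]
    · rfl

theorem localHom_mulVec_refState (n : Fin N) {X : Matrix (Fin 2) (Fin 2) ℂ} (hX : X 1 0 = 0) :
    localHom n X *ᵥ refState N = X 0 0 • refState N := by
  have h := refState_vecMul_localHom (N := N) n (X := Xᵀ) hX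
  have ht : localHom n Xᵀ = (localHom n X)ᵀ := by
    ext s s'
    simp only [localHom_apply, localOp, Matrix.of_apply, Matrix.transpose_apply, eq_comm]
  rwa [ht, Matrix.vecMul_transpose] at h

theorem siteLax_false (n : Fin N) (l : ℂ) (i j : Fin 2) :
    siteLax q η (n, false) l i j = localHom n (smallLax q (l / η n) i j) := by
  simp [siteLax, lax_eq_map]

theorem refState_chain (s : List (Fin N)) (hs : s.Nodup) (l : ℂ) :
    refState N ᵥ* chain q η (s.map fun n => (n, false)) l 0 1 = 0 ∧
      refState N ᵥ* chain q η (s.map fun n => (n, false)) l 1 1 =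
        (s.map fun n => l / η n - η n / l).prod • refState N := by
  induction s with
  | nil => simp [chain_nil]
  | cons n s ih =>
    rw [List.nodup_cons] at hs
    obtain ⟨h1, h2⟩ := ih hs.2
    -- The local C does not preserve the reference covector; moved to the right, it lets the
    -- remaining chain's B act first and give zero.
    have hc := localHom_commute_chain q η n (smallLax q (l / η n) 1 0) (s.map fun n => (n, false))
      (by rw [map_fst_pair]; exact hs.1) l 0 1
    simp only [List.map_cons, chain_cons, Matrix.mul_apply, Fin.sum_univ_two, siteLax_false,
      Matrix.vecMul_add, hc.eq]
    simp only [← Matrix.vecMul_vecMul, h1, Matrix.zero_vecMul, zero_add]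
    rw [refState_vecMul_localHom n (by simp [smallLax]),
      refState_vecMul_localHom n (by simp [smallLax]),
      refState_vecMul_localHom n (by simp [smallLax])]
    simp [Matrix.smul_vecMul, h1, h2, smallLax, rDiag, smul_smul]

theorem chain_refState (s : List (Fin N)) (hs : s.Nodup) (l : ℂ) :
    chain q η (s.map fun n => (n, false)) l 1 0 *ᵥ refState N = 0 ∧
      chain q η (s.map fun n => (n, false)) l 1 1 *ᵥ refState N =
        (s.map fun n => l / η n - η n / l).prod • refState N := by
  induction s with
  | nil => simp [chain_nil]
  | cons n s ih =>
    rw [List.nodup_cons] at hs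
    obtain ⟨h1, h2⟩ := ih hs.2
    have hc := fun j => localHom_commute_chain q η n (smallLax q (l / η n) 1 0)
      (s.map fun n => (n, false)) (by rw [map_fst_pair]; exact hs.1) l 0 j
    simp only [List.map_cons, chain_cons, Matrix.mul_apply, Fin.sum_univ_two, siteLax_false,
      Matrix.add_mulVec, (hc _).eq]
    simp only [← Matrix.mulVec_mulVec, h1, h2, Matrix.mulVec_zero, add_zero, Matrix.mulVec_smul]
    rw [localHom_mulVec_refState n (by simp [smallLax]),
      localHom_mulVec_refState n (by simp [smallLax])]
    simp [smallLax, rDiag, smul_smul, mul_comm]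

theorem prod_map_reverse_finRange (l : ℂ) :
    ((List.finRange N).reverse.map fun n => l / η n - η n / l).prod = dFun η l := by
  rw [List.map_reverse, List.prod_reverse, ← List.ofFn_eq_map, List.prod_ofFn, dFun]

theorem refState_monodromy (l : ℂ) :
    refState N ᵥ* monodromy q η l 0 1 = 0 ∧
      refState N ᵥ* monodromy q η l 1 1 = dFun η l • refState N := by
  rw [monodromy_eq_chain, ← prod_map_reverse_finRange]
  exact refState_chain _ (List.nodup_reverse.2 (List.nodup_finRange N)) l

theorem monodromy_refState (l : ℂ) :
    monodromy q η l 1 0 *ᵥ refState N = 0 ∧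
      monodromy q η l 1 1 *ᵥ refState N = dFun η l • refState N := by
  rw [monodromy_eq_chain, ← prod_map_reverse_finRange]
  exact chain_refState _ (List.nodup_reverse.2 (List.nodup_finRange N)) l

theorem prod_ofFn_pow_update {M : Type*} [Monoid M] {N : ℕ} (f : Fin N → M)
    (hf : ∀ i j, Commute (f i) (f j)) (e : Fin N → ℕ) (a : Fin N) :
    (List.ofFn fun n => f n ^ Function.update e a (e a + 1) n).prod =
      (List.ofFn fun n => f n ^ e n).prod * f a := by
  induction N with
  | zero => exact a.elim0
  | succ N ih =>
    rw [List.ofFn_succ, List.ofFn_succ, List.prod_cons, List.prod_cons]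
    cases a using Fin.cases with
    | zero =>
      have : Commute (f 0) (List.ofFn fun n : Fin N => f n.succ ^ e n.succ).prod := by
        refine Commute.list_prod_right _ _ fun x hx => ?_
        obtain ⟨n, rfl⟩ := (List.mem_ofFn' _ _).1 hx
        exact (hf _ _).pow_right _
      simp only [Function.update_self, Function.update_of_ne (Fin.succ_ne_zero _), pow_succ]
      rw [mul_assoc, this.eq, mul_assoc]
    | succ a =>
      have := ih (fun n => f n.succ) (fun i j => hf _ _) (fun n => e n.succ) a
      rw [mul_assoc, ← this, Function.update_of_ne (Fin.succ_ne_zero a).symm]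
      congr 3
      funext n
      by_cases hn : n = a
      · subst hn; simp
      · simp [hn]

theorem prod_ofFn_pow_conf {M : Type*} [Monoid M] (f : Fin N → M)
    (hf : ∀ i j, Commute (f i) (f j)) {h : Conf N} {a : Fin N} (ha : h a = 0) :
    (List.ofFn fun n => f n ^ (Function.update h a 1 n : ℕ)).prod =
      (List.ofFn fun n => f n ^ (h n : ℕ)).prod * f a := by
  rw [← prod_ofFn_pow_update f hf]
  congr 2
  funext n
  by_cases hn : n = a
  · subst hn; simp [ha]
  · simp [hn]

/-- The genericity condition on the inhomogeneities. -/
def Generic (q : ℂ) (η : Fin N → ℂ) : Prop :=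
  (∀ a, η a ≠ 0) ∧ (∀ a b, a ≠ b → η a ^ 2 ≠ η b ^ 2) ∧ ∀ a b, η a ^ 2 ≠ q ^ 2 * η b ^ 2

theorem generic_of_lt (hq0 : q ≠ 0) (hq1 : q ^ 2 ≠ 1) (hη0 : ∀ a, η a ≠ 0)
    (hη : ∀ a b : Fin N, a < b → ∀ j : ℤ, j ∈ ({-1, 0, 1} : Set ℤ) →
      η a ^ 2 ≠ q ^ (2 * j) * η b ^ 2) : Generic q η := by
  refine ⟨hη0, fun a b hab => ?_, fun a b => ?_⟩
  · rcases lt_or_gt_of_ne hab with h | h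
    · simpa using hη a b h 0 (by simp)
    · simpa using (hη b a h 0 (by simp)).symm
  · rcases lt_trichotomy a b with h | h | h
    · simpa [zpow_ofNat] using hη a b h 1 (by simp)
    · subst h
      intro hc
      exact hq1 (mul_right_cancel₀ (pow_ne_zero 2 (hη0 a)) (by rw [one_mul, ← hc]))
    · intro hc
      refine hη b a h (-1) (by simp) ?_
      rw [hc, show q ^ (2 * (-1) : ℤ) = (q ^ 2)⁻¹ by simp [zpow_neg, zpow_ofNat],
        inv_mul_cancel_left₀ (pow_ne_zero 2 hq0)]

theorem div_sub_div_ne_zero {x y : ℂ} (hx : x ≠ 0) (hy : y ≠ 0) (h : x ^ 2 ≠ y ^ 2) :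
    x / y - y / x ≠ 0 := by
  rw [div_sub_div _ _ hy hx, ← sq, ← sq]
  exact div_ne_zero (sub_ne_zero.2 h) (mul_ne_zero hy hx)

theorem dFun_ne_zero (hq : q ≠ 0) (hg : Generic q η) (a : Fin N) : dFun η (η a / q) ≠ 0 := by
  refine Finset.prod_ne_zero_iff.2 fun b _ =>
    div_sub_div_ne_zero (div_ne_zero (hg.1 a) hq) (hg.1 b) ?_
  rw [div_pow, Ne, div_eq_iff (pow_ne_zero 2 hq), mul_comm]
  exact hg.2.2 a b

theorem aFun_ne_zero (hq : q ≠ 0) (hg : Generic q η) (a : Fin N) : aFun q η (η a) ≠ 0 := by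
  refine neg_ne_zero.2 (Finset.prod_ne_zero_iff.2 fun b _ =>
    div_sub_div_ne_zero (mul_ne_zero (hg.1 a) hq) (hg.1 b) ?_)
  rw [mul_pow, mul_comm]
  exact (hg.2.2 b a).symm

theorem rDiag_self_ne_zero (hq : q ≠ 0) (hg : Generic q η) (a b : Fin N) (i : Fin 2) :
    rDiag q (η a / η b) i i ≠ 0 := by
  have h := div_sub_div_ne_zero (mul_ne_zero (hg.1 a) hq) (hg.1 b)
    (by rw [mul_pow, mul_comm]; exact (hg.2.2 b a).symm)
  have ha := hg.1 a
  have hb := hg.1 b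
  convert h using 1
  simp only [rDiag, if_true]
  field_simp

/-- For equal row indices and equal column indices the exchange relation is diagonal, with the same
nonzero weight on both sides. -/
theorem commute_of_rtt {A : Type*} [Ring A] [Algebra ℂ A] {T : ℂ → Matrix (Fin 2) (Fin 2) A}
    (hT : RTT q T) (hq : q ≠ 0) (hg : Generic q η) {i k : Fin 2} (a b : Fin N) :
    Commute (T (η a) i k) (T (η b) i k) := by
  have h := hT (η a) (η b) (hg.1 a) (hg.1 b) i i k k
  have e : rDiag q (η a / η b) k k = rDiag q (η a / η b) i i := by simp [rDiag]
  simp only [rOff, if_true, zero_smul, add_zero, e] at h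
  exact smul_right_injective A (rDiag_self_ne_zero hq hg a b i) h

theorem leftSov_zero (ν : ℂ) : leftSov q η ν 0 = ν⁻¹ • refState N := by
  simp [leftSov]

theorem rightSov_zero (ν : ℂ) : rightSov q η ν 0 = ν⁻¹ • refState N := by
  simp [rightSov]

theorem isSov_leftSov (hq : q ≠ 0) (hg : Generic q η) (ν : ℂ) :
    IsSov q η (fun a => (dFun η (η a / q))⁻¹) (monodromy q η) (leftSov q η ν) where
  rtt := rtt_monodromy hq hg.1
  continuousAt _ hl i j := continuousAt_monodromy hq hg.1 hl i j
  zero_B l _ := by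
    rw [leftSov_zero, Matrix.smul_vecMul, (refState_monodromy l).1, smul_zero]
  zero_D l _ := by
    rw [leftSov_zero, Matrix.smul_vecMul, (refState_monodromy l).2, smul_comm]
  update h a ha := by
    rw [leftSov, prod_ofFn_pow_conf _ _ ha, leftSov, ← Matrix.vecMul_vecMul, Matrix.vecMul_smul,
      Matrix.smul_vecMul, smul_comm]
    · rfl
    · intro i j
      exact ((commute_of_rtt (rtt_monodromy hq hg.1) hq hg i j).smul_right _).smul_left _

/-- Transposition turns B into the raising entry, so the whole theory of left states applies to
right states. -/
theorem isSov_rightSov (hq : q ≠ 0) (hg : Generic q η) (ν : ℂ) :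
    IsSov q η (fun a => (aFun q η (η a))⁻¹) (coTranspose (monodromy q η)) (rightSov q η ν) where
  rtt := (rtt_monodromy hq hg.1).coTranspose
  continuousAt _ hl i j :=
    (continuous_id.matrix_transpose).continuousAt.comp (continuousAt_monodromy hq hg.1 hl j i)
  zero_B l _ := by
    rw [rightSov_zero, coTranspose, Matrix.of_apply, Matrix.vecMul_transpose, Matrix.mulVec_smul,
      (monodromy_refState l).1, smul_zero]
  zero_D l _ := by
    rw [rightSov_zero, coTranspose, Matrix.of_apply, Matrix.vecMul_transpose, Matrix.mulVec_smul,
      (monodromy_refState l).2, smul_comm]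
  update h a ha := by
    have hc : ∀ i j : Fin N, Commute ((aFun q η (η i))⁻¹ • opB q η (η i))
        ((aFun q η (η j))⁻¹ • opB q η (η j)) := fun i j =>
      ((commute_of_rtt (rtt_monodromy hq hg.1) hq hg i j).smul_right _).smul_left _
    have hc' : Commute ((aFun q η (η a))⁻¹ • opB q η (η a))
        (List.ofFn fun n : Fin N => ((aFun q η (η n))⁻¹ • opB q η (η n)) ^ (h n : ℕ)).prod := by
      refine Commute.list_prod_right _ _ fun x hx => ?_
      obtain ⟨n, rfl⟩ := (List.mem_ofFn' _ _).1 hx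
      exact (hc _ _).pow_right _
    rw [rightSov, prod_ofFn_pow_conf _ hc ha, ← hc'.eq, ← Matrix.mulVec_mulVec, rightSov,
      Matrix.smul_mulVec, coTranspose, Matrix.of_apply, Matrix.vecMul_transpose,
      Matrix.mulVec_smul, smul_comm]
    rfl

end Reference


/-! ### Products over pairs of sites -/

section Pairs

variable {N : ℕ}

/-- The factors that involve site c are isolated. The sign does not depend on x, so it disappears
when two values of `x c` are compared in `prod_Iio_update`. -/
theorem prod_Iio_eq {R : Type*} [CommRing R] (g : R → R → R) (hg : ∀ y z, g y z = -g z y)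
    (x : Fin N → R) (c : Fin N) :
    ∏ a, ∏ b ∈ Finset.Iio a, g (x a) (x b) =
      (-1) ^ (Finset.Ioi c).card * (∏ b ∈ Finset.univ.erase c, g (x c) (x b)) *
        ∏ a ∈ Finset.univ.erase c, ∏ b ∈ (Finset.Iio a).erase c, g (x a) (x b) := by
  have h1 : ∀ a ∈ Finset.univ.erase c, ∏ b ∈ Finset.Iio a, g (x a) (x b) =
      (if c < a then g (x a) (x c) else 1) * ∏ b ∈ (Finset.Iio a).erase c, g (x a) (x b) := by
    intro a _
    split_ifs with h
    · rw [Finset.mul_prod_erase _ (fun b => g (x a) (x b)) (Finset.mem_Iio.2 h)]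
    · rw [one_mul, Finset.erase_eq_of_notMem (by simpa using h)]
  have h2 : (Finset.univ.erase c).filter (c < ·) = Finset.Ioi c := by
    ext a
    simp only [Finset.mem_filter, Finset.mem_erase, Finset.mem_univ, and_true, Finset.mem_Ioi]
    exact ⟨fun h => h.2, fun h => ⟨h.ne', h⟩⟩
  have h3 : (Finset.univ.erase c).filter (¬ c < ·) = Finset.Iio c := by
    ext a
    simp only [Finset.mem_filter, Finset.mem_erase, Finset.mem_univ, and_true, Finset.mem_Iio]
    exact ⟨fun h => lt_of_le_of_ne (not_lt.1 h.2) h.1, fun h => ⟨h.ne, h.not_gt⟩⟩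
  have h4 : ∏ b ∈ Finset.univ.erase c, g (x c) (x b) =
      (∏ b ∈ Finset.Ioi c, g (x c) (x b)) * ∏ b ∈ Finset.Iio c, g (x c) (x b) := by
    rw [← Finset.prod_filter_mul_prod_filter_not (Finset.univ.erase c) (c < ·), h2, h3]
  rw [← Finset.mul_prod_erase _ _ (Finset.mem_univ c), Finset.prod_congr rfl h1,
    Finset.prod_mul_distrib, ← Finset.prod_filter, h2, h4,
    Finset.prod_congr rfl fun a _ => hg (x a) (x c), Finset.prod_neg]
  ring

theorem prod_Iio_update {R : Type*} [CommRing R] (g : R → R → R) (hg : ∀ y z, g y z = -g z y)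
    (x : Fin N → R) (c : Fin N) (y : R) :
    (∏ a, ∏ b ∈ Finset.Iio a, g (Function.update x c y a) (Function.update x c y b)) *
        ∏ b ∈ Finset.univ.erase c, g (x c) (x b) =
      (∏ a, ∏ b ∈ Finset.Iio a, g (x a) (x b)) * ∏ b ∈ Finset.univ.erase c, g y (x b) := by
  rw [prod_Iio_eq g hg _ c, prod_Iio_eq g hg x c]
  have h1 : ∏ b ∈ Finset.univ.erase c, g (Function.update x c y c) (Function.update x c y b) =
      ∏ b ∈ Finset.univ.erase c, g y (x b) :=
    Finset.prod_congr rfl fun b hb => by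
      rw [Function.update_self, Function.update_of_ne (Finset.ne_of_mem_erase hb)]
  have h2 : ∏ a ∈ Finset.univ.erase c, ∏ b ∈ (Finset.Iio a).erase c,
      g (Function.update x c y a) (Function.update x c y b) =
      ∏ a ∈ Finset.univ.erase c, ∏ b ∈ (Finset.Iio a).erase c, g (x a) (x b) :=
    Finset.prod_congr rfl fun a ha => Finset.prod_congr rfl fun b hb => by
      rw [Function.update_of_ne (Finset.ne_of_mem_erase ha),
        Function.update_of_ne (Finset.ne_of_mem_erase hb)]
  rw [h1, h2]
  ring

theorem prod_Iio_mul (x : Fin N → ℂ) :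
    ∏ a, ∏ b ∈ Finset.Iio a, x a * x b = ∏ a, x a ^ (N - 1) := by
  have h : ∏ a, ∏ b ∈ Finset.Iio a, x b = ∏ b, ∏ _a ∈ Finset.Ioi b, x b :=
    Finset.prod_comm' fun _ _ => by simp
  simp only [Finset.prod_mul_distrib, h, Finset.prod_const, Fin.card_Iio, Fin.card_Ioi]
  rw [← Finset.prod_mul_distrib]
  refine Finset.prod_congr rfl fun a _ => ?_
  rw [← pow_add]
  congr 1
  omega

end Pairs

/-! ### Norms and completeness of the separated basis -/

section Norm

variable {N : ℕ} {q : ℂ} {η : Fin N → ℂ}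

/-- The inverse of the pairing of the separated covector and vector labelled by `h`. -/
def weight (q : ℂ) (η : Fin N → ℂ) (h : Conf N) : ℂ :=
  ∏ a, ∏ b ∈ Finset.Iio a, (node q η h a / node q η h b - node q η h b / node q η h a)

theorem node_update_one (h : Conf N) (a : Fin N) :
    node q η (Function.update h a 1) = Function.update (node q η h) a (η a / q) := by
  funext b
  by_cases hb : b = a
  · subst hb
    rw [Function.update_self, node_one (by simp)]
  · rw [node_update hb, Function.update_of_ne hb]

theorem node_sq_ne (hq : q ≠ 0) (hg : Generic q η) (h : Conf N) {a b : Fin N} (hab : a ≠ b) :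
    node q η h a ^ 2 ≠ node q η h b ^ 2 := by
  have hq2 : q ^ 2 ≠ 0 := pow_ne_zero 2 hq
  have h1 : ∀ a b, η a ^ 2 / q ^ 2 ≠ η b ^ 2 := fun a b => by
    rw [Ne, div_eq_iff hq2, mul_comm]
    exact hg.2.2 a b
  have cases : ∀ c, h c = 0 ∨ h c = 1 := fun c => by omega
  rcases cases a with ha | ha <;> rcases cases b with hb | hb <;>
    simp only [node_zero, node_one, ha, hb, div_pow]
  · exact hg.2.1 a b hab
  · exact (h1 b a).symm
  · exact h1 a b
  · exact fun hc => hg.2.1 a b hab ((div_left_inj' hq2).1 hc)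

theorem weight_ne_zero (hq : q ≠ 0) (hg : Generic q η) (h : Conf N) : weight q η h ≠ 0 :=
  Finset.prod_ne_zero_iff.2 fun _ _ => Finset.prod_ne_zero_iff.2 fun _ hb =>
    div_sub_div_ne_zero (node_ne_zero hq hg.1 h _) (node_ne_zero hq hg.1 h _)
      (node_sq_ne hq hg h (Finset.mem_Iio.1 hb).ne')

/-- Each node lies in N - 1 pairs, so the factors ω are exactly what turns differences of squares
into the symmetric form of `weight`. -/
theorem sepCoeff_eq (hq : q ≠ 0) (hη : ∀ a, η a ≠ 0) (f : ℂ → ℂ) (h : Conf N) :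
    sepCoeff q η f h = (∏ a, f (node q η h a)) * weight q η h := by
  have hn := node_ne_zero hq hη h
  have h1 : ∏ a, ∏ b ∈ Finset.Iio a, (node q η h a ^ 2 - node q η h b ^ 2) =
      weight q η h * ∏ a, omega N (node q η h a) := by
    have h2 : ∏ a, omega N (node q η h a) = ∏ a, node q η h a ^ (N - 1) := by
      refine Finset.prod_congr rfl fun a _ => ?_
      rw [omega, ← zpow_natCast, Nat.cast_sub (Nat.one_le_of_lt a.2), Nat.cast_one]
    rw [h2, ← prod_Iio_mul, weight, ← Finset.prod_mul_distrib]
    refine Finset.prod_congr rfl fun a _ => ?_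
    rw [← Finset.prod_mul_distrib]
    refine Finset.prod_congr rfl fun b _ => ?_
    have := hn a
    have := hn b
    field_simp
  have h3 : ∏ a, omega N (node q η h a) ≠ 0 :=
    Finset.prod_ne_zero_iff.2 fun a _ => zpow_ne_zero _ (hn a)
  rw [sepCoeff, h1, Finset.prod_div_distrib]
  field_simp

/-- The norm recursion matches the change of `weight` when one node moves from η_a to η_a/q. The
condition on ν fixes the value at h = 0. -/
theorem leftSov_dotProduct_rightSov (hq : q ≠ 0) (hq1 : q ^ 2 ≠ 1) (hg : Generic q η) {ν : ℂ}
    (hν : ν ^ 2 = ∏ a : Fin N, ∏ b ∈ Finset.Iio a, (η a / η b - η b / η a)) (h k : Conf N) :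
    leftSov q η ν h ⬝ᵥ rightSov q η ν k = if h = k then (weight q η h)⁻¹ else 0 := by
  have hL := isSov_leftSov hq hg ν
  have hR := isSov_rightSov hq hg ν
  split_ifs with hhk
  swap
  · exact dotProduct_eq_zero_of_sov hL hR hq hg.1 hg.2.1 hhk
  subst hhk
  rw [← mul_eq_one_iff_eq_inv₀ (weight_ne_zero hq hg h)]
  induction h using conf_induction with
  | h0 =>
    have : weight q η 0 = ν ^ 2 := by
      rw [hν, weight]
      simp [node]
    have h0 : ν ^ 2 ≠ 0 := this ▸ weight_ne_zero hq hg 0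
    have h1 : ν ≠ 0 := by simpa using h0
    rw [this, leftSov_zero, rightSov_zero, smul_dotProduct, dotProduct_smul, refState]
    simp
    field_simp
  | hs h a ha ih =>
    have h1 := dotProduct_update_of_sov hL hR (qDet_monodromy hq hg.1) hq hg.1 hg.2.1 ha
    have h2 := prod_Iio_update (fun y z : ℂ => y / z - z / y) (fun _ _ => by ring) (node q η h) a
      (η a / q)
    rw [← node_update_one] at h2
    change weight q η _ * _ = weight q η h * dRest q η h a (η a / q) at h2
    rw [node_zero ha] at h2
    change _ * dRest q η h a (η a) = _ at h2
    have hne : ∀ b ≠ a, (η a / q) ^ 2 ≠ node q η h b ^ 2 := fun b hb => by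
      have := node_sq_ne hq hg (Function.update h a 1) hb.symm
      rwa [node_update hb, node_one (by simp)] at this
    have hr : dRest q η h a (η a / q) ≠ 0 := Finset.prod_ne_zero_iff.2 fun b hb =>
      div_sub_div_ne_zero (div_ne_zero (hg.1 a) hq) (node_ne_zero hq hg.1 h b)
        (hne b (Finset.ne_of_mem_erase hb))
    have hr' : dRest q η h a (η a) ≠ 0 := Finset.prod_ne_zero_iff.2 fun b hb => by
      have := node_sq_ne hq hg h (Finset.ne_of_mem_erase hb).symm
      rw [node_zero ha] at this
      exact div_sub_div_ne_zero (hg.1 a) (node_ne_zero hq hg.1 h b) this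
    have hd := dFun_ne_zero hq hg a
    have ha' := aFun_ne_zero hq hg a
    have hκ : q - q⁻¹ ≠ 0 := by
      intro hc
      have : q ^ 2 - 1 = q * (q - q⁻¹) := by field_simp
      rw [hc, mul_zero] at this
      exact hq1 (sub_eq_zero.1 this)
    have e1 : η a / q / η a - η a / (η a / q) = -(q - q⁻¹) := by
      have := hg.1 a
      field_simp
      ring
    -- The normalisations of the left and right states cancel the quantum determinant up to a sign.
    have e2 : (dFun η (η a / q))⁻¹ * (aFun q η (η a))⁻¹ * (q - q⁻¹) * dRest q η h a (η a) *
        -(aFun q η (η a) * dFun η (η a / q)) = -(q - q⁻¹) * dRest q η h a (η a) := by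
      field_simp
    rw [dNode_eq h a, node_zero ha, e1, e2] at h1
    have h3 : leftSov q η ν (Function.update h a 1) ⬝ᵥ rightSov q η ν (Function.update h a 1) *
        dRest q η h a (η a / q) =
        dRest q η h a (η a) * (leftSov q η ν h ⬝ᵥ rightSov q η ν h) := by
      refine mul_left_cancel₀ (neg_ne_zero.2 hκ) ?_
      linear_combination h1
    refine mul_right_cancel₀ (mul_ne_zero hr hr') ?_
    linear_combination (weight q η (Function.update h a 1) * dRest q η h a (η a)) * h3 +
      (dRest q η h a (η a) * (leftSov q η ν h ⬝ᵥ rightSov q η ν h)) * h2 +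
      (dRest q η h a (η a) * dRest q η h a (η a / q)) * ih

/-- Completeness: the families are square matrices, so a one-sided inverse is two-sided. -/
theorem eq_sum_of_biorthogonal {κ : Type*} [Fintype κ] [DecidableEq κ] {u v : κ → κ → ℂ}
    {w : κ → ℂ} (hw : ∀ h, w h ≠ 0)
    (huv : ∀ h k, u h ⬝ᵥ v k = if h = k then (w h)⁻¹ else 0) (x : κ → ℂ) :
    x = ∑ h, (w h * (u h ⬝ᵥ x)) • v h := by
  have h1 : Matrix.of u * (Matrix.of fun s h => w h * v h s) = 1 := by
    ext h k
    have : (Matrix.of u * (Matrix.of fun s h => w h * v h s)) h k = w k * (u h ⬝ᵥ v k) := by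
      simp only [Matrix.mul_apply, Matrix.of_apply, dotProduct, Finset.mul_sum]
      exact Finset.sum_congr rfl fun s _ => by ring
    rw [this, huv, Matrix.one_apply]
    split_ifs with hk
    · subst hk; exact mul_inv_cancel₀ (hw h)
    · rw [mul_zero]
  have h2 := mul_eq_one_comm.1 h1
  conv_lhs => rw [← Matrix.one_mulVec x, ← h2, ← Matrix.mulVec_mulVec]
  funext s
  simp only [Finset.sum_apply, Pi.smul_apply, smul_eq_mul, Matrix.mulVec, Matrix.of_apply]
  refine Finset.sum_congr rfl fun h _ => ?_
  change w h * v h s * (u h ⬝ᵥ x) = _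
  ring

theorem prod_of_update {F : Conf N → ℂ} {r : Fin N → ℂ}
    (hF : ∀ h a, h a = 0 → F (Function.update h a 1) = r a * F h) (h : Conf N) :
    F h = F 0 * ∏ a, r a ^ (h a : ℕ) := by
  induction h using conf_induction with
  | h0 => simp
  | hs h a ha ih =>
    have h1 : ∏ b ∈ Finset.univ.erase a, r b ^ (Function.update h a 1 b : ℕ) =
        ∏ b ∈ Finset.univ.erase a, r b ^ (h b : ℕ) :=
      Finset.prod_congr rfl fun b hb => by
        rw [Function.update_of_ne (Finset.ne_of_mem_erase hb)]
    rw [hF h a ha, ih, ← Finset.mul_prod_erase _ _ (Finset.mem_univ a),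
      ← Finset.mul_prod_erase _ (fun b => r b ^ (Function.update h a 1 b : ℕ)) (Finset.mem_univ a),
      h1]
    simp [ha]
    ring

/-- A function with prescribed nonzero value of the product over the `η_a`, and with prescribed
ratios of its values at `η_a / q` and `η_a`. -/
theorem exists_wave (hq : q ≠ 0) (hg : Generic q η) (n : Fin N) {c : ℂ} (hc : c ≠ 0)
    (r : Fin N → ℂ) :
    ∃ f : ℂ → ℂ, (∀ a, f (η a) ≠ 0 ∧ f (η a / q) / f (η a) = r a) ∧
      ∀ h : Conf N, ∏ a, f (node q η h a) = c * ∏ a, r a ^ (h a : ℕ) := by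
  -- The overall constant is placed on the single site n, which is why a site must exist.
  set f₀ : Fin N → ℂ := Function.update 1 n c with hf₀
  have h0 : ∀ a, f₀ a ≠ 0 := fun a => by
    by_cases ha : a = n
    · subst ha; simpa [hf₀] using hc
    · simp [hf₀, ha]
  have inj : Function.Injective η := fun a b hab => by
    by_contra hne
    exact hg.2.1 a b hne (by rw [hab])
  have inj' : Function.Injective fun a => η a / q := fun a b hab =>
    inj ((div_left_inj' hq).1 hab)
  set f := Function.extend η f₀ (Function.extend (fun a => η a / q) (fun a => f₀ a * r a) 0)
  have h1 : ∀ a, f (η a) = f₀ a := fun a => inj.extend_apply _ _ a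
  -- Genericity makes the points η_a/q disjoint from the η_b, so both sets of values can be
  -- prescribed.
  have h2 : ∀ a, f (η a / q) = f₀ a * r a := fun a => by
    have : ¬∃ b, η b = η a / q := by
      rintro ⟨b, hb⟩
      refine hg.2.2 a b ?_
      rw [hb, div_pow, mul_div_cancel₀ _ (pow_ne_zero 2 hq)]
    exact (Function.extend_apply' _ _ _ this).trans (inj'.extend_apply _ _ a)
  refine ⟨f, fun a => ⟨h1 a ▸ h0 a, ?_⟩, fun h => ?_⟩
  · rw [h1, h2, mul_div_cancel_left₀ _ (h0 a)]
  · have h3 : ∀ a, f (node q η h a) = f₀ a * r a ^ (h a : ℕ) := fun a => by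
      have : h a = 0 ∨ h a = 1 := by omega
      rcases this with ha | ha
      · rw [node_zero ha, h1, ha]; simp
      · rw [node_one ha, h2, ha]; simp
    have h4 : ∏ a, f₀ a = c := by
      rw [hf₀, Finset.prod_update_of_mem (Finset.mem_univ n)]
      simp
    rw [Finset.prod_congr rfl fun a _ => h3 a, Finset.prod_mul_distrib, h4]

/-- The coordinates are u 0 ⬝ᵥ x times a product over sites. This constant is nonzero, since
otherwise x = 0, and the wave function absorbs it. -/
theorem exists_wave_of_biorthogonal (hq : q ≠ 0) (hg : Generic q η) (n : Fin N)
    {u v : Conf N → Conf N → ℂ}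
    (huv : ∀ h k, u h ⬝ᵥ v k = if h = k then (weight q η h)⁻¹ else 0) {x : Conf N → ℂ}
    (hx : x ≠ 0) (r : Fin N → ℂ)
    (hr : ∀ h a, h a = 0 → u (Function.update h a 1) ⬝ᵥ x = r a * (u h ⬝ᵥ x)) :
    ∃ f : ℂ → ℂ, (∀ a, f (η a) ≠ 0 ∧ f (η a / q) / f (η a) = r a) ∧
      x = ∑ h, sepCoeff q η f h • v h := by
  have hsum := eq_sum_of_biorthogonal (weight_ne_zero hq hg) huv x
  have hux := prod_of_update (F := fun h => u h ⬝ᵥ x) hr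
  have h0 : u 0 ⬝ᵥ x ≠ 0 := fun hc => hx (by
    rw [hsum]
    refine Finset.sum_eq_zero fun h _ => ?_
    have := hux h
    simp only [hc, zero_mul] at this
    rw [this, mul_zero, zero_smul])
  obtain ⟨f, hf, hprod⟩ := exists_wave hq hg n h0 r
  refine ⟨f, hf, ?_⟩
  conv_lhs => rw [hsum]
  refine Finset.sum_congr rfl fun h _ => ?_
  rw [sepCoeff_eq hq hg.1, hprod, ← hux h, mul_comm]

theorem exists_isRightWave (hq : q ≠ 0) (hq1 : q ^ 2 ≠ 1) (hg : Generic q η) {ν : ℂ}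
    (hν : ν ^ 2 = ∏ a : Fin N, ∏ b ∈ Finset.Iio a, (η a / η b - η b / η a)) (n : Fin N)
    {t : ℂ → ℂ} {R : Vec N} (hR : IsRightEigenstate q η t R) :
    ∃ Q, IsRightWave q η ν t R Q := by
  refine exists_wave_of_biorthogonal hq hg n (leftSov_dotProduct_rightSov hq hq1 hg hν) hR.1
    (fun a => t (η a) / dFun η (η a / q)) fun h a ha => ?_
  rw [(isSov_leftSov hq hg ν).vecMul_transfer hq hg.1 hg.2.1 h ha, smul_dotProduct,
    ← Matrix.dotProduct_mulVec]
  change _ • (_ ⬝ᵥ transfer q η (η a) *ᵥ R) = _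
  rw [hR.2 _ (hg.1 a), dotProduct_smul, smul_eq_mul, smul_eq_mul]
  ring

/-- The roles of the two bases are exchanged: coordinates come from the right states, whose raising
operators carry 1/a(η_a) instead of 1/d(η_a/q). -/
theorem exists_isLeftWave (hq : q ≠ 0) (hq1 : q ^ 2 ≠ 1) (hg : Generic q η) {ν : ℂ}
    (hν : ν ^ 2 = ∏ a : Fin N, ∏ b ∈ Finset.Iio a, (η a / η b - η b / η a)) (n : Fin N)
    {t : ℂ → ℂ} {L : Vec N} (hL : IsLeftEigenstate q η t L) :
    ∃ Q, IsLeftWave q η ν t L Q := by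
  refine exists_wave_of_biorthogonal hq hg n (u := rightSov q η ν) (v := leftSov q η ν)
    (fun h k => ?_) hL.1 (fun a => t (η a) / aFun q η (η a)) fun h a ha => ?_
  · rw [dotProduct_comm, leftSov_dotProduct_rightSov hq hq1 hg hν]
    by_cases hhk : h = k
    · subst hhk; simp
    · rw [if_neg hhk, if_neg (Ne.symm hhk)]
  · have h1 : coTranspose (monodromy q η) (η a) 0 1 + coTranspose (monodromy q η) (η a) 1 0 =
        (transfer q η (η a))ᵀ := by
      rw [transfer, opB, opC, Matrix.transpose_add, add_comm]
      rfl
    rw [(isSov_rightSov hq hg ν).vecMul_transfer hq hg.1 hg.2.1 h ha, h1, smul_dotProduct,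
      Matrix.vecMul_transpose, dotProduct_comm, Matrix.dotProduct_mulVec, hL.2 _ (hg.1 a),
      smul_dotProduct, dotProduct_comm, smul_eq_mul, smul_eq_mul]
    ring

/-- The matrix elements of the lower right entry of the monodromy matrix between separate states. -/
theorem leftSep_dotProduct_rightSep (hq : q ≠ 0) (hq1 : q ^ 2 ≠ 1) (hg : Generic q η) {ν : ℂ}
    (hν : ν ^ 2 = ∏ a : Fin N, ∏ b ∈ Finset.Iio a, (η a / η b - η b / η a)) (f g : ℂ → ℂ) {l : ℂ}
    (hl : l ≠ 0) :
    leftSep q η ν f ⬝ᵥ (monodromy q η l 1 1 *ᵥ rightSep q η ν g) =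
      ∑ h : Conf N, (∏ a, g (node q η h a) * f (node q η h a)) * (weight q η h * dNode q η h l) := by
  rw [leftSep, sum_dotProduct]
  refine Finset.sum_congr rfl fun h _ => ?_
  rw [smul_dotProduct, Matrix.dotProduct_mulVec, (isSov_leftSov hq hg ν).vecMul_D hq hg.1 h hl,
    smul_dotProduct, rightSep, dotProduct_sum,
    Finset.sum_eq_single h (fun k _ hk => by
      rw [dotProduct_smul, leftSov_dotProduct_rightSov hq hq1 hg hν, if_neg hk.symm, smul_zero])
      (by simp),
    dotProduct_smul, leftSov_dotProduct_rightSov hq hq1 hg hν, if_pos rfl,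
    sepCoeff_eq hq hg.1, sepCoeff_eq hq hg.1, Finset.prod_mul_distrib]
  have := weight_ne_zero hq hg h
  simp only [smul_eq_mul]
  field_simp

end Norm

/-! ### The determinant -/

section Det

variable {N : ℕ} {q : ℂ} {η : Fin N → ℂ}

/-- Multilinearity in all rows but the last. -/
theorem det_snoc_sum {R : Type*} [CommRing R] {m : ℕ} {κ : Type*} [Fintype κ] [DecidableEq κ]
    (F : Fin m → κ → Fin (m + 1) → R) (y : Fin (m + 1) → R) :
    (Matrix.of (Fin.snoc (α := fun _ => Fin (m + 1) → R) (fun a b => ∑ c, F a c b) y)).det =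
      ∑ h : Fin m → κ,
        (Matrix.of (Fin.snoc (α := fun _ => Fin (m + 1) → R) (fun a => F a (h a)) y)).det := by
  have key : ∀ z : Fin m → Fin (m + 1) → R,
      (Matrix.of (Fin.snoc (α := fun _ => Fin (m + 1) → R) z y)).det =
      (Matrix.detRowAlternating (n := Fin (m + 1)) (R := R)).toMultilinearMap.curryRight z y :=
    fun z => rfl
  simp only [key]
  have : (fun a b => ∑ c, F a c b) = fun a => ∑ c, F a c := by
    funext a b
    rw [Finset.sum_apply]
  rw [this, MultilinearMap.map_sum, LinearMap.sum_apply]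

theorem det_snoc_powers {m : ℕ} (f x : Fin m → ℂ) (hx : ∀ a, x a ≠ 0) {y : ℂ} (hy : y ≠ 0) :
    (Matrix.of (Fin.snoc (α := fun _ => Fin (m + 1) → ℂ)
      (fun a b => f a * x a ^ (2 * ((b : ℕ) : ℤ) - 1))
      fun b => y ^ (2 * ((b : ℕ) : ℤ) - (m : ℤ)))).det =
      (∏ a, f a) * ((∏ a, (y / x a - x a / y)) *
        ∏ a, ∏ b ∈ Finset.Iio a, (x a ^ 2 - x b ^ 2)) := by
  -- Taking 1/x_a and y^{-m} out of the rows leaves a Vandermonde matrix in the squares.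
  have h1 : Matrix.of (Fin.snoc (α := fun _ => Fin (m + 1) → ℂ)
      (fun a b => f a * x a ^ (2 * ((b : ℕ) : ℤ) - 1))
      fun b => y ^ (2 * ((b : ℕ) : ℤ) - (m : ℤ))) =
      Matrix.of fun i j => Fin.snoc (α := fun _ => ℂ) (fun a => f a / x a) ((y ^ m)⁻¹) i *
        Matrix.vandermonde (Fin.snoc (α := fun _ => ℂ) (fun a => x a ^ 2) (y ^ 2)) i j := by
    ext i j
    cases i using Fin.lastCases with
    | last =>
      simp only [Matrix.of_apply, Fin.snoc_last, Matrix.vandermonde_apply]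
      rw [zpow_sub₀ hy, zpow_mul, zpow_natCast, zpow_natCast, zpow_ofNat]
      field_simp
    | cast a =>
      simp only [Matrix.of_apply, Fin.snoc_castSucc, Matrix.vandermonde_apply]
      rw [zpow_sub₀ (hx a), zpow_mul, zpow_natCast, zpow_one, zpow_ofNat]
      field_simp
  have h2 : ∀ z : Fin (m + 1) → ℂ, ∏ i, ∏ j ∈ Finset.Ioi i, (z j - z i) =
      (∏ a : Fin m, (z (Fin.last m) - z a.castSucc)) *
        ∏ a : Fin m, ∏ b ∈ Finset.Iio a, (z a.castSucc - z b.castSucc) := by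
    intro z
    rw [Finset.prod_comm' (t' := Finset.univ) (s' := fun j => Finset.Iio j) fun _ _ => by simp,
      Fin.prod_univ_castSucc, mul_comm]
    congr 1
    · have : Finset.Iio (Fin.last m) = Finset.univ.map Fin.castSuccEmb := by
        ext i
        cases i using Fin.lastCases <;> simp
      rw [this, Finset.prod_map]
      rfl
    · refine Finset.prod_congr rfl fun a _ => ?_
      rw [← Fin.map_castSuccEmb_Iio, Finset.prod_map]
      rfl
  rw [h1, Matrix.det_mul_column, Matrix.det_vandermonde, h2, Fin.prod_univ_castSucc]
  simp only [Fin.snoc_castSucc, Fin.snoc_last]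
  rw [Finset.prod_div_distrib]
  have h3 : ∏ a, (y / x a - x a / y) = (∏ a, (y ^ 2 - x a ^ 2)) / ((∏ a, x a) * y ^ m) := by
    have : y ^ m = ∏ _a : Fin m, y := by simp
    rw [this, ← Finset.prod_mul_distrib, ← Finset.prod_div_distrib]
    refine Finset.prod_congr rfl fun a _ => ?_
    have := hx a
    field_simp
  rw [h3]
  have : ∏ a, x a ≠ 0 := Finset.prod_ne_zero_iff.2 fun a _ => hx a
  field_simp

theorem phiHalf_eq (Qbar Q : ℂ → ℂ) (a : Fin N) (k : ℤ) :
    phiHalf q η Qbar Q a k = ∑ c : Fin 2,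
      Q (η a * q ^ (-((c : ℕ) : ℤ))) * Qbar (η a * q ^ (-((c : ℕ) : ℤ))) /
        omega N (η a * q ^ (-((c : ℕ) : ℤ))) * (η a * q ^ (-((c : ℕ) : ℤ))) ^ (k - 2) := by
  rw [phiHalf, Finset.sum_range, Finset.mul_sum]
  refine Finset.sum_congr rfl fun c _ => ?_
  rw [mul_zpow, ← zpow_mul, show -((c : ℕ) : ℤ) * (k - 2) = -((k - 2) * ((c : ℕ) : ℤ)) by ring]
  ring

/-- Each choice of c in the first N rows is a configuration h. The last row adds the node η_n²,
whose differences with the others produce the eigenvalue of D(η_n), so the sum is that of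
`leftSep_dotProduct_rightSep`. -/
theorem det_formMatrix (hq : q ≠ 0) (hη : ∀ a, η a ≠ 0) (Qbar Q : ℂ → ℂ) (n : Fin N) :
    (formMatrix q η Qbar Q n).det =
      ∑ h : Conf N, (∏ a, Q (node q η h a) * Qbar (node q η h a)) *
        (weight q η h * dNode q η h (η n)) := by
  have h1 : formMatrix q η Qbar Q n = Matrix.of (Fin.snoc (α := fun _ => Fin (N + 1) → ℂ)
      (fun a b => ∑ c : Fin 2, Q (η a * q ^ (-((c : ℕ) : ℤ))) * Qbar (η a * q ^ (-((c : ℕ) : ℤ))) /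
        omega N (η a * q ^ (-((c : ℕ) : ℤ))) *
          (η a * q ^ (-((c : ℕ) : ℤ))) ^ (2 * ((b : ℕ) : ℤ) - 1))
      (fun b => η n ^ (2 * ((b : ℕ) : ℤ) - (N : ℤ)))) := by
    rw [formMatrix]
    congr 2
    funext a b
    rw [phiHalf_eq]
    refine Finset.sum_congr rfl fun c _ => ?_
    congr 2
    ring
  rw [h1, det_snoc_sum fun a (c : Fin 2) (b : Fin (N + 1)) =>
    Q (η a * q ^ (-((c : ℕ) : ℤ))) * Qbar (η a * q ^ (-((c : ℕ) : ℤ))) /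
        omega N (η a * q ^ (-((c : ℕ) : ℤ))) *
          (η a * q ^ (-((c : ℕ) : ℤ))) ^ (2 * ((b : ℕ) : ℤ) - 1)]
  refine Finset.sum_congr rfl fun h _ => ?_
  have h2 := det_snoc_powers (fun a => Q (node q η h a) * Qbar (node q η h a) /
    omega N (node q η h a)) (node q η h) (node_ne_zero hq hη h) (hη n)
  have h3 := sepCoeff_eq hq hη (fun z => Q z * Qbar z) h
  rw [sepCoeff] at h3
  refine h2.trans ?_
  rw [mul_left_comm, h3, dNode]
  ring

end Det

end AntiXXZ

end

theorem mainTheorem4 (N : ℕ) (q : ℂ) (hq0 : q ≠ 0) (hq1 : q ^ 2 ≠ 1)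
    (η : Fin N → ℂ) (hη0 : ∀ a, η a ≠ 0)
    (hη : ∀ a b : Fin N, a < b → ∀ j : ℤ, j ∈ ({-1, 0, 1} : Set ℤ) →
      η a ^ 2 ≠ q ^ (2 * j) * η b ^ 2)
    (ν : ℂ) (hν : ν ^ 2 = ∏ a : Fin N, ∏ b ∈ Finset.Iio a, (η a / η b - η b / η a))
    (n : Fin N) (t t' : ℂ → ℂ) (L R : AntiXXZ.Vec N)
    (hL : AntiXXZ.IsLeftEigenstate q η t L) (hR : AntiXXZ.IsRightEigenstate q η t' R) :
    (∃ Qbar : ℂ → ℂ, AntiXXZ.IsLeftWave q η ν t L Qbar) ∧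
    (∃ Q : ℂ → ℂ, AntiXXZ.IsRightWave q η ν t' R Q) ∧
    ∀ Qbar Q : ℂ → ℂ, AntiXXZ.IsLeftWave q η ν t L Qbar → AntiXXZ.IsRightWave q η ν t' R Q →
      L ⬝ᵥ (AntiXXZ.sigmaMinus n *ᵥ R) =
        (∏ h ∈ Finset.Iio n, t (η h)) * (∏ h ∈ Finset.Iic n, t' (η h / q)) /
            (∏ h ∈ Finset.Iic n, AntiXXZ.aFun q η (η h) * AntiXXZ.dFun η (η h / q)) *
          (AntiXXZ.formMatrix q η Qbar Q n).det := by
  have hg := AntiXXZ.generic_of_lt hq0 hq1 hη0 hη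
  refine ⟨AntiXXZ.exists_isLeftWave hq0 hq1 hg hν n hL,
    AntiXXZ.exists_isRightWave hq0 hq1 hg hν n hR, fun Qbar Q hQbar hQ => ?_⟩
  rw [AntiXXZ.dotProduct_sigmaMinus hq0 hη0 (fun a => mul_ne_zero
    (AntiXXZ.aFun_ne_zero hq0 hg a) (AntiXXZ.dFun_ne_zero hq0 hg a)) hL hR n,
    AntiXXZ.det_formMatrix hq0 hη0, hQbar.2, hQ.2,
    AntiXXZ.leftSep_dotProduct_rightSep hq0 hq1 hg hν Qbar Q (hη0 n)]
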